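/- **Conventions.** All rings are commutative with $1$. A *bounded archimedean $\ell$-algebra* is an $\mathbb R$-algebra $A$ with a lattice order such that: $a\le b$ implies $a+c\le b+c$; $0\le a,b$ implies $0\le ab$; $0\le\lambda\in\mathbb R$ and $0\le a$ imply $0\le\lambda a$; for each $a$ there is $n\in\mathbb N$ with $a\le n\cdot 1$; and if $na\le b$ for all $n\in\mathbb N$, then $a\le 0$. Put $|a|=a\vee(-a)$, $a^+=a\vee 0$, $\|a\|=\inf\{\lambda\in\mathbb R: |a|\le\lambda\cdot 1\}$. $A$ is *uniformly complete* if every $\|\cdot\|$-Cauchy sequence converges, and *clean* if each element is the sum of an idempotent and a unit. A *modal operator* on $A$ is a map $\Box:A\to A$ such that for all $a,b\in A$, $\lambda\in\mathbb R$: $\Box(a\wedge b)=\Box a\wedge\Box b$; $\Box\lambda=\lambda+(1-\lambda)\Box 0$; $\Box(a^+)=(\Box a)^+$; $\Box(a+\lambda)=\Box a+\Box\lambda-\Box 0$; and $\Box(\lambda a)=(\Box\lambda)(\Box a)$ if $\lambda\ge 0$. Let $\boldsymbol{mcuba\ell}$ be the category of pairs $(A,\Box)$ with $A$ a clean, uniformly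 complete, bounded archimedean $\ell$-algebra and $\Box$ a modal operator on $A$; morphisms are unital $\ell$-algebra homomorphisms preserving $\Box$. Let $\mathsf{MA}$ be the category of modal algebras: boolean algebras with a unary $\Box$ preserving finite meets (including $1$), with boolean homomorphisms preserving $\Box$. Let $\mathsf{DF}$ be the category of descriptive frames: pairs $(X,R)$ with $X$ a Stone space and $R$ a binary relation such that each $R[x]$ is closed, $R^{-1}[F]$ is closed for $F$ closed, and $R^{-1}[U]$ is open for $U$ open; morphisms are continuous maps $f:(X,R)\to(Y,S)$ with $f(R[x])=S[f(x)]$ for all $x\in X$. **Functors.** * $\mathrm{Id}:\boldsymbol{mcuba\ell}\to\mathsf{MA}$ sends $(A,\Box)$ to the boolean algebra of idempotents of $A$ ($e\wedge f=ef$, $e\vee f=e+f-ef$, $\neg e=1-e$) with the restriction of $\Box$, and a morphism to its restriction. * $(-)_*:\boldsymbol{mcuba\ell}\to\mathsf{DF}$ (contravariant) sends $(A,\Box)$ to $(Y_A,R_\Box)$, where $Y_A$ is the set of maximal $\ell$-ideals of $A$ (an $\ell$-ideal is an ideal $I$ such that $|a|\le|b|$, $b\in I$ imply $a\in I$), with closed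 sets $\{M: I\subseteq M\}$ for $\ell$-ideals $I$, and $xR_\Box y$ iff $\Box a\in x$ for every $0\le a\in y$; it sends $\alpha$ to $\alpha^{-1}$. * $(-)^*:\mathsf{DF}\to\boldsymbol{mcuba\ell}$ (contravariant) sends $(X,R)$ to $(C(X),\Box_R)$, where $C(X)$ is the ring of continuous real-valued functions and $(\Box_Rf)(x)=\inf f(R[x])$ if $R[x]\neq\varnothing$, $(\Box_Rf)(x)=1$ otherwise; it sends $\varphi$ to $f\mapsto f\circ\varphi$. * $(-)_*:\mathsf{MA}\to\mathsf{DF}$ (contravariant) sends $(A,\Box)$ to the Stone space of ultrafilters of $A$ with $xR_\Box y$ iff $\Box^{-1}x\subseteq y$, and $h$ to $h^{-1}$. * $(-)^*:\mathsf{DF}\to\mathsf{MA}$ (contravariant) sends $(X,R)$ to the boolean algebra of clopen subsets of $X$ with $\Box_RU=X\setminus R^{-1}[X\setminus U]$, and $f$ to $f^{-1}$. **Theorem.** The functor $\mathrm{Id}:\boldsymbol{mcuba\ell}\to\mathsf{MA}$ is an equivalence of categories, and the triangle $$\boldsymbol{mcuba\ell}\xrightarrow{\ \mathrm{Id}\ }\mathsf{MA},\qquad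 \boldsymbol{mcuba\ell}\rightleftarrows\mathsf{DF},\qquad \mathsf{MA}\rightleftarrows\mathsf{DF}$$ formed by these functors commutes up to natural isomorphism. That is: $(\mathrm{Id}(-))_*\cong(-)_*$ as contravariant functors $\boldsymbol{mcuba\ell}\to\mathsf{DF}$; $\mathrm{Id}((-)^*)\cong(-)^*$ as contravariant functors $\mathsf{DF}\to\mathsf{MA}$; and each of the two pairs $(-)_*,(-)^*$ is a dual equivalence, i.e. both composites of $(-)_*$ and $(-)^*$ are naturally isomorphic to the identity functors, on $\boldsymbol{mcuba\ell}$ and $\mathsf{DF}$, respectively on $\mathsf{MA}$ and $\mathsf{DF}$. -/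

import Mathlib

set_option linter.unusedSectionVars false

universe u

open CategoryTheory

namespace ModalDuality

/-! ### Bounded archimedean lattice-ordered algebras -/

/-- A commutative unital real algebra with a lattice order is a bounded archimedean
`ℓ`-algebra. -/
class IsBal (A : Type*) [CommRing A] [Lattice A] [Algebra ℝ A] : Prop where
  add_le_add : ∀ a b c : A, a ≤ b → a + c ≤ b + c
  mul_nonneg : ∀ a b : A, 0 ≤ a → 0 ≤ b → 0 ≤ a * b
  smul_nonneg : ∀ (r : ℝ) (a : A), 0 ≤ r → 0 ≤ a → 0 ≤ r • a
  bounded : ∀ a : A, ∃ n : ℕ, a ≤ n • (1 : A)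
  archimedean : ∀ a b : A, (∀ n : ℕ, n • a ≤ b) → a ≤ 0

/-- The norm `‖a‖ = inf {r | |a| ≤ r}`. -/
noncomputable def unifNorm {A : Type*} [CommRing A] [Lattice A] [Algebra ℝ A] (a : A) : ℝ :=
  sInf {r : ℝ | |a| ≤ algebraMap ℝ A r}

/-- Every Cauchy sequence for `unifNorm` converges for `unifNorm`. -/
def IsUnifComplete (A : Type*) [CommRing A] [Lattice A] [Algebra ℝ A] : Prop :=
  ∀ s : ℕ → A,
    (∀ ε : ℝ, 0 < ε → ∃ N : ℕ, ∀ m ≥ N, ∀ n ≥ N, unifNorm (s m - s n) < ε) →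
    ∃ a : A, ∀ ε : ℝ, 0 < ε → ∃ N : ℕ, ∀ n ≥ N, unifNorm (s n - a) < ε

/-- Every element is the sum of an idempotent and a unit. -/
def IsCleanRing (A : Type*) [CommRing A] : Prop :=
  ∀ a : A, ∃ e v : A, IsIdempotentElem e ∧ IsUnit v ∧ a = e + v

/-- The axioms of a modal operator; here `a ⊔ 0` is the positive part of `a`, and a real number
`r` is identified with `r • 1`. -/
structure IsModalOp {A : Type*} [CommRing A] [Lattice A] [Algebra ℝ A] (box : A → A) : Prop where
  map_inf : ∀ a b : A, box (a ⊓ b) = box a ⊓ box b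
  map_const : ∀ r : ℝ,
    box (algebraMap ℝ A r) = algebraMap ℝ A r + (1 - algebraMap ℝ A r) * box 0
  map_pos : ∀ a : A, box (a ⊔ 0) = box a ⊔ 0
  map_add_const : ∀ (a : A) (r : ℝ),
    box (a + algebraMap ℝ A r) = box a + box (algebraMap ℝ A r) - box 0
  map_const_mul : ∀ (r : ℝ) (a : A), 0 ≤ r →
    box (algebraMap ℝ A r * a) = box (algebraMap ℝ A r) * box a

/-- An `ℓ`-ideal: `|a| ≤ |b|` and `b ∈ I` imply `a ∈ I`. -/
def IsLIdeal {A : Type*} [CommRing A] [Lattice A] (I : Ideal A) : Prop :=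
  ∀ a b : A, |a| ≤ |b| → b ∈ I → a ∈ I

/-- A maximal `ℓ`-ideal: maximal among the proper `ℓ`-ideals. -/
structure IsMaxLIdeal {A : Type*} [CommRing A] [Lattice A] (M : Ideal A) : Prop where
  isLIdeal : IsLIdeal M
  ne_top : M ≠ ⊤
  eq_of_le : ∀ J : Ideal A, IsLIdeal J → J ≠ ⊤ → M ≤ J → J = M

/-- The points of the Yosida space: the maximal `ℓ`-ideals. -/
def Yosida (A : Type*) [CommRing A] [Lattice A] : Type _ := {M : Ideal A // IsMaxLIdeal M}

section Bal

variable {A : Type*} [CommRing A] [Lattice A] [Algebra ℝ A] [hA : IsBal A]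

instance isOrderedAddMonoid_of_isBal : IsOrderedAddMonoid A where
  add_le_add_left a b h c := IsBal.add_le_add a b c h

theorem zero_le_one_of_isBal : (0 : A) ≤ 1 := by
  obtain ⟨n, hn⟩ := hA.bounded ((1 : A) ⊔ 0)
  have h1 : (1 : A) ≤ n • (1 : A) := le_sup_left.trans hn
  have h0 : (0 : A) ≤ n • (1 : A) := le_sup_right.trans hn
  rcases Nat.eq_zero_or_pos n with rfl | hpos
  · rw [zero_smul] at h1
    have h2 : (0 : A) ≤ -1 := by simpa using h1
    simpa using hA.mul_nonneg _ _ h2 h2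
  · have := hA.smul_nonneg ((n : ℝ)⁻¹) _ (by positivity) h0
    have h3 : ((n : ℝ)⁻¹) • (n • (1 : A)) = 1 := by
      rw [← Nat.cast_smul_eq_nsmul ℝ, smul_smul, inv_mul_cancel₀, one_smul]
      exact_mod_cast hpos.ne'
    rwa [h3] at this

instance isOrderedRing_of_isBal : IsOrderedRing A :=
  { zero_le_one := zero_le_one_of_isBal
    mul_le_mul_of_nonneg_left := fun a ha b c hbc => by
      have := hA.mul_nonneg _ _ ha (sub_nonneg.2 hbc)
      rwa [mul_sub, sub_nonneg] at this
    mul_le_mul_of_nonneg_right := fun a ha b c hbc => by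
      have := hA.mul_nonneg _ _ (sub_nonneg.2 hbc) ha
      rwa [sub_mul, sub_nonneg] at this }

theorem const_nonneg {r : ℝ} (hr : 0 ≤ r) : (0 : A) ≤ algebraMap ℝ A r := by
  rw [Algebra.algebraMap_eq_smul_one]
  exact hA.smul_nonneg r 1 hr zero_le_one_of_isBal

theorem const_mono {r s : ℝ} (h : r ≤ s) : algebraMap ℝ A r ≤ algebraMap ℝ A s := by
  have := const_nonneg (A := A) (sub_nonneg.2 h)
  rwa [map_sub, sub_nonneg] at this

theorem exists_le_const (a : A) : ∃ r : ℝ, 0 < r ∧ a ≤ algebraMap ℝ A r := by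
  obtain ⟨n, hn⟩ := hA.bounded a
  refine ⟨n + 1, by positivity, hn.trans ?_⟩
  have : n • (1 : A) = algebraMap ℝ A n := by simp
  rw [this]
  exact const_mono (by linarith)

theorem abs_mul_le' (a b : A) : |a * b| ≤ |a| * |b| := by
  have ha1 := sub_nonneg.2 (le_abs_self a)
  have ha2 := sub_nonneg.2 (neg_le_abs a)
  have hb1 := sub_nonneg.2 (le_abs_self b)
  have hb2 := sub_nonneg.2 (neg_le_abs b)
  have key : ∀ c : A, 0 ≤ 2 * c → 0 ≤ c := by
    intro c hc
    have := hA.smul_nonneg (1 / 2) _ (by norm_num) hc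
    have h2 : ((1 / 2 : ℝ)) • (2 * c) = c := by
      rw [two_mul, smul_add, ← add_smul]; norm_num
    rwa [h2] at this
  refine abs_le'.2 ⟨sub_nonneg.1 (key _ ?_), sub_nonneg.1 (key _ ?_)⟩
  · have := add_nonneg (hA.mul_nonneg _ _ ha1 hb2) (hA.mul_nonneg _ _ ha2 hb1)
    convert this using 1; ring
  · have := add_nonneg (hA.mul_nonneg _ _ ha1 hb1) (hA.mul_nonneg _ _ ha2 hb2)
    convert this using 1; ring

theorem IsLIdeal.mem_of_le {I : Ideal A} (hI : IsLIdeal I) {a b : A} (ha : 0 ≤ a) (hab : a ≤ b)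
    (hb : b ∈ I) : a ∈ I :=
  hI a b (by rwa [abs_of_nonneg ha, abs_of_nonneg (ha.trans hab)]) hb

theorem IsLIdeal.abs_mem {I : Ideal A} (hI : IsLIdeal I) {a : A} (ha : a ∈ I) : |a| ∈ I :=
  hI _ a (by rw [abs_abs]) ha

/-- The `ℓ`-ideal generated by an ideal and one element. -/
def adjoinL (I : Ideal A) (c : A) : Ideal A where
  carrier := {x | ∃ m ∈ I, 0 ≤ m ∧ ∃ r : ℝ, 0 < r ∧ |x| ≤ m + algebraMap ℝ A r * |c|}
  add_mem' := by
    rintro x y ⟨m, hm, h0, r, hr, hx⟩ ⟨m', hm', h0', r', hr', hy⟩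
    refine ⟨m + m', I.add_mem hm hm', add_nonneg h0 h0', r + r', by positivity, ?_⟩
    refine (abs_add_le x y).trans ((_root_.add_le_add hx hy).trans (le_of_eq ?_))
    rw [map_add]; ring
  zero_mem' := ⟨0, I.zero_mem, le_rfl, 1, one_pos, by simp⟩
  smul_mem' := by
    rintro x y ⟨m, hm, h0, r, hr, hx⟩
    obtain ⟨s, hs, hxs⟩ := exists_le_const |x|
    refine ⟨algebraMap ℝ A s * m, I.mul_mem_left _ hm, mul_nonneg (const_nonneg hs.le) h0,
      s * r, by positivity, ?_⟩
    refine (abs_mul_le' x y).trans ((mul_le_mul hxs hx (abs_nonneg _)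
      (const_nonneg hs.le)).trans (le_of_eq ?_))
    rw [map_mul]; ring

theorem adjoinL_isLIdeal (I : Ideal A) (c : A) : IsLIdeal (adjoinL I c) := by
  rintro a b hab ⟨m, hm, h0, r, hr, hx⟩
  exact ⟨m, hm, h0, r, hr, hab.trans hx⟩

theorem mem_adjoinL (I : Ideal A) (c : A) : c ∈ adjoinL I c :=
  ⟨0, I.zero_mem, le_rfl, 1, one_pos, by simp⟩

theorem le_adjoinL {I : Ideal A} (hI : IsLIdeal I) (c : A) : I ≤ adjoinL I c := fun x hx =>
  ⟨|x|, hI.abs_mem hx, abs_nonneg x, 1, one_pos, by simp⟩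

theorem const_notMem {I : Ideal A} (hI : I ≠ ⊤) {r : ℝ} (hr : r ≠ 0) :
    algebraMap ℝ A r ∉ I := fun h =>
  hI (Ideal.eq_top_of_isUnit_mem I h ((isUnit_iff_ne_zero.2 hr).map (algebraMap ℝ A)))

theorem IsMaxLIdeal.exists_one_le {M : Ideal A} (hM : IsMaxLIdeal M) {c : A} (hc : c ∉ M) :
    ∃ m ∈ M, 0 ≤ m ∧ ∃ r : ℝ, 0 < r ∧ 1 ≤ m + algebraMap ℝ A r * |c| := by
  have htop : adjoinL M c = ⊤ := by
    by_contra h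
    have := hM.eq_of_le _ (adjoinL_isLIdeal M c) h (le_adjoinL hM.isLIdeal c)
    exact hc (this ▸ mem_adjoinL M c)
  obtain ⟨m, hm, h0, r, hr, h1⟩ : (1 : A) ∈ adjoinL M c := htop ▸ Submodule.mem_top
  exact ⟨m, hm, h0, r, hr, (le_abs_self 1).trans h1⟩

theorem le_of_const_mul_le {r : ℝ} (hr : 0 < r) {a b : A}
    (h : a ≤ algebraMap ℝ A r * b) : algebraMap ℝ A r⁻¹ * a ≤ b := by
  have := mul_le_mul_of_nonneg_left h (const_nonneg (A := A) (inv_pos.2 hr).le)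
  rwa [← mul_assoc, ← map_mul, inv_mul_cancel₀ hr.ne', map_one, one_mul] at this

theorem le_of_const_mul_le' {r : ℝ} (hr : 0 < r) {a : A}
    (h : algebraMap ℝ A r * a ≤ 0) : a ≤ 0 := by
  have := mul_le_mul_of_nonneg_left h (const_nonneg (A := A) (inv_pos.2 hr).le)
  rwa [← mul_assoc, ← map_mul, inv_mul_cancel₀ hr.ne', map_one, one_mul, mul_zero] at this

theorem IsMaxLIdeal.mem_or_mem {M : Ideal A} (hM : IsMaxLIdeal M) {a b : A} (ha : 0 ≤ a)
    (hb : 0 ≤ b) (hab : a ⊓ b ≤ 0) : a ∈ M ∨ b ∈ M := by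
  by_contra h
  push Not at h
  obtain ⟨m, hm, h0, r, hr, h1⟩ := hM.exists_one_le h.1
  obtain ⟨m', hm', h0', r', hr', h1'⟩ := hM.exists_one_le h.2
  rw [abs_of_nonneg ha] at h1
  rw [abs_of_nonneg hb] at h1'
  have hs : 0 < r + r' := by positivity
  have e1 : 1 - (m + m') ≤ algebraMap ℝ A (r + r') * a := by
    have : 0 ≤ algebraMap ℝ A r' * a := mul_nonneg (const_nonneg hr'.le) ha
    rw [map_add, add_mul, sub_le_iff_le_add]
    calc (1 : A) ≤ m + algebraMap ℝ A r * a := h1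
      _ ≤ (m + algebraMap ℝ A r * a) + (m' + algebraMap ℝ A r' * a) :=
          le_add_of_nonneg_right (add_nonneg h0' this)
      _ = _ := by ring
  have e2 : 1 - (m + m') ≤ algebraMap ℝ A (r + r') * b := by
    have : 0 ≤ algebraMap ℝ A r * b := mul_nonneg (const_nonneg hr.le) hb
    rw [map_add, add_mul, sub_le_iff_le_add]
    calc (1 : A) ≤ m' + algebraMap ℝ A r' * b := h1'
      _ ≤ (m' + algebraMap ℝ A r' * b) + (m + algebraMap ℝ A r * b) :=
          le_add_of_nonneg_right (add_nonneg h0 this)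
      _ = _ := by ring
  have e3 := (le_inf (le_of_const_mul_le hs e1) (le_of_const_mul_le hs e2)).trans hab
  have e4 : (1 : A) ≤ m + m' := sub_nonpos.1 (le_of_const_mul_le' (inv_pos.2 hs) e3)
  have := hM.isLIdeal.mem_of_le zero_le_one_of_isBal e4 (M.add_mem hm hm')
  exact hM.ne_top ((Ideal.eq_top_iff_one M).2 this)

theorem pos_inf_neg (a : A) : (a ⊔ 0) ⊓ (-a ⊔ 0) ≤ 0 := by
  have : a ⊔ 0 = (-a ⊔ 0) + a := by
    rw [sup_add, neg_add_cancel, zero_add, sup_comm]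
  rw [this]
  have h2 : ((-a ⊔ 0) + a) ⊓ (-a ⊔ 0) = (-a ⊔ 0) + (a ⊓ 0) := by
    rw [add_inf, add_zero]
  rw [h2, inf_comm a 0]
  have h3 : (-a ⊔ 0) = -(0 ⊓ a) := by rw [neg_inf, neg_zero, sup_comm]
  rw [h3, neg_add_cancel]

theorem IsMaxLIdeal.pos_or_neg {M : Ideal A} (hM : IsMaxLIdeal M) (a : A) :
    a ⊔ 0 ∈ M ∨ -a ⊔ 0 ∈ M :=
  hM.mem_or_mem le_sup_right le_sup_right (pos_inf_neg a)

/-- An element that is infinitesimal modulo a maximal `ℓ`-ideal belongs to it. -/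
theorem IsMaxLIdeal.mem_of_forall {M : Ideal A} (hM : IsMaxLIdeal M) {c : A}
    (h : ∀ ε : ℝ, 0 < ε → ∃ m ∈ M, |c| ≤ m + algebraMap ℝ A ε) : c ∈ M := by
  by_contra hc
  obtain ⟨m, hm, h0, r, hr, h1⟩ := hM.exists_one_le hc
  obtain ⟨m', hm', h2⟩ := h (1 / (2 * r)) (by positivity)
  have h3 := mul_le_mul_of_nonneg_left h2 (const_nonneg (A := A) hr.le)
  have h4 : (1 : A) ≤ m + (algebraMap ℝ A r * m' + algebraMap ℝ A (1 / 2)) := by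
    refine h1.trans ((add_le_add_iff_left m).2 (h3.trans (le_of_eq ?_)))
    rw [mul_add, ← map_mul]; congr 2; field_simp
  have h5 : algebraMap ℝ A (1 / 2) ≤ m + algebraMap ℝ A r * m' := by
    rw [← add_assoc, ← sub_le_iff_le_add, ← map_one (algebraMap ℝ A), ← map_sub] at h4
    norm_num at h4 ⊢
    exact h4
  exact const_notMem hM.ne_top (by norm_num) (hM.isLIdeal.mem_of_le (const_nonneg (by norm_num)) h5
    (M.add_mem hm (M.mul_mem_left _ hm')))

theorem IsMaxLIdeal.exists_value {M : Ideal A} (hM : IsMaxLIdeal M) (a : A) :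
    ∃ r : ℝ, a - algebraMap ℝ A r ∈ M := by
  set S : Set ℝ := {r | (a - algebraMap ℝ A r) ⊔ 0 ∈ M} with hS
  obtain ⟨n, hn, han⟩ := exists_le_const a
  obtain ⟨k, hk, hak⟩ := exists_le_const (-a)
  have hne : S.Nonempty := ⟨n, by
    have : (a - algebraMap ℝ A n) ⊔ 0 = 0 := sup_eq_right.2 (sub_nonpos.2 han)
    simp only [hS, Set.mem_ofPred_eq, this, M.zero_mem]⟩
  have hbd : BddBelow S := ⟨-k, fun r hr => by
    by_contra! hlt
    refine const_notMem hM.ne_top (r := -k - r) (by linarith) (hM.isLIdeal.mem_of_le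
      (const_nonneg (by linarith)) (le_trans ?_ le_sup_left) hr)
    rw [map_sub, map_neg]
    exact sub_le_sub_right (neg_le.1 hak) _⟩
  refine ⟨sInf S, hM.mem_of_forall fun ε hε => ?_⟩
  obtain ⟨r, hr, hrlt⟩ := exists_lt_of_csInf_lt hne (lt_add_of_pos_right (sInf S) hε)
  have hnot : sInf S - ε ∉ S := fun h => by linarith [csInf_le hbd h]
  have hneg : -(a - algebraMap ℝ A (sInf S - ε)) ⊔ 0 ∈ M :=
    (hM.pos_or_neg _).resolve_left hnot
  refine ⟨_, M.add_mem hr hneg, abs_le'.2 ⟨?_, ?_⟩⟩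
  · have h1 : a - algebraMap ℝ A r ≤ (a - algebraMap ℝ A r) ⊔ 0 := le_sup_left
    have h2 : (0 : A) ≤ -(a - algebraMap ℝ A (sInf S - ε)) ⊔ 0 := le_sup_right
    have h3 := const_mono (A := A) hrlt.le
    rw [map_add] at h3
    rw [sub_le_iff_le_add]
    calc a = (a - algebraMap ℝ A r) + 0 + algebraMap ℝ A r := by ring
      _ ≤ _ := _root_.add_le_add (_root_.add_le_add h1 h2) h3
      _ = _ := by ring
  · have h1 : -(a - algebraMap ℝ A (sInf S - ε)) ≤ -(a - algebraMap ℝ A (sInf S - ε)) ⊔ 0 :=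
      le_sup_left
    have h2 : (0 : A) ≤ (a - algebraMap ℝ A r) ⊔ 0 := le_sup_right
    have e : -(a - algebraMap ℝ A (sInf S)) =
        0 + -(a - algebraMap ℝ A (sInf S - ε)) + algebraMap ℝ A ε := by
      rw [map_sub]; ring
    rw [e]
    exact add_le_add_left (_root_.add_le_add h2 h1) _

/-- The real number `r` with `a + M = r + M`. -/
noncomputable def value (x : Yosida A) (a : A) : ℝ := (x.2.exists_value a).choose

theorem value_spec (x : Yosida A) (a : A) : a - algebraMap ℝ A (value x a) ∈ x.1 :=
  (x.2.exists_value a).choose_spec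

theorem value_eq {x : Yosida A} {a : A} {r : ℝ} (h : a - algebraMap ℝ A r ∈ x.1) :
    value x a = r := by
  by_contra hne
  refine const_notMem x.2.ne_top (sub_ne_zero.2 hne) ?_
  have := x.1.sub_mem h (value_spec x a)
  rw [map_sub]
  convert this using 1; ring

theorem value_eq_zero {x : Yosida A} {a : A} : value x a = 0 ↔ a ∈ x.1 :=
  ⟨fun h => by simpa [h] using value_spec x a, fun h => value_eq (by simpa using h)⟩

/-- Evaluation at a maximal `ℓ`-ideal, as an algebra homomorphism. -/
noncomputable def ev (x : Yosida A) : A →ₐ[ℝ] ℝ where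
  toFun := value x
  map_one' := value_eq (by simp)
  map_zero' := value_eq (by simp)
  map_add' a b := value_eq (by
    have := x.1.add_mem (value_spec x a) (value_spec x b)
    rw [map_add]; convert this using 1; ring)
  map_mul' a b := value_eq (by
    have := x.1.add_mem (x.1.mul_mem_left a (value_spec x b))
      (x.1.mul_mem_left (algebraMap ℝ A (value x b)) (value_spec x a))
    rw [map_mul]; convert this using 1; ring)
  commutes' r := value_eq (by simp)

theorem ev_eq_zero {x : Yosida A} {a : A} : ev x a = 0 ↔ a ∈ x.1 := value_eq_zero

theorem ev_const (x : Yosida A) (r : ℝ) : ev x (algebraMap ℝ A r) = r := (ev x).commutes r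

theorem ev_nonneg (x : Yosida A) {a : A} (ha : 0 ≤ a) : 0 ≤ ev x a := by
  by_contra! h
  have h1 : a + algebraMap ℝ A (-ev x a) ∈ x.1 := by
    rw [← ev_eq_zero, map_add, ev_const]; ring
  exact const_notMem x.2.ne_top (r := -ev x a) (by linarith) (x.2.isLIdeal.mem_of_le
    (const_nonneg (by linarith)) (le_add_of_nonneg_left ha) h1)

theorem ev_mono (x : Yosida A) {a b : A} (h : a ≤ b) : ev x a ≤ ev x b := by
  have := ev_nonneg x (sub_nonneg.2 h)
  rw [map_sub] at this; linarith

theorem ev_pos (x : Yosida A) (a : A) : ev x (a ⊔ 0) = ev x a ⊔ 0 := by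
  have e : a ⊔ 0 = (-a ⊔ 0) + a := by rw [sup_add, neg_add_cancel, zero_add, sup_comm]
  have h1 := ev_mono x (le_sup_left : a ≤ a ⊔ 0)
  have h2 := ev_mono x (le_sup_right : 0 ≤ a ⊔ 0)
  rw [map_zero] at h2
  rcases x.2.pos_or_neg a with h | h
  · rw [← ev_eq_zero] at h
    rw [h] at h1 ⊢
    exact (sup_eq_right.2 h1).symm
  · rw [← ev_eq_zero] at h
    rw [e, map_add, h, zero_add] at h2 ⊢
    exact (sup_eq_left.2 h2).symm

theorem ev_sup (x : Yosida A) (a b : A) : ev x (a ⊔ b) = ev x a ⊔ ev x b := by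
  have e : a ⊔ b = ((a - b) ⊔ 0) + b := by rw [sup_add, sub_add_cancel, zero_add]
  rw [e, map_add, ev_pos, map_sub, max_add, sub_add_cancel, zero_add]

theorem ev_inf (x : Yosida A) (a b : A) : ev x (a ⊓ b) = ev x a ⊓ ev x b := by
  have e : a ⊓ b = -(-a ⊔ -b) := by rw [neg_sup, neg_neg, neg_neg]
  rw [e, map_neg, ev_sup, map_neg, map_neg, max_neg_neg, neg_neg]

theorem ev_abs (x : Yosida A) (a : A) : ev x |a| = |ev x a| := by
  rw [abs, ev_sup, map_neg, abs]

/-- The kernel of a homomorphism to the reals is a maximal `ℓ`-ideal. -/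
theorem isMaxLIdeal_ker (f : A →ₐ[ℝ] ℝ) (hf : ∀ a, f |a| = |f a|) :
    IsMaxLIdeal (RingHom.ker f) where
  isLIdeal a b hab hb := by
    have hpos : ∀ c : A, 0 ≤ c → 0 ≤ f c := fun c hc => by
      rw [← abs_of_nonneg hc, hf]; exact abs_nonneg _
    have h1 := hpos _ (sub_nonneg.2 hab)
    rw [RingHom.mem_ker] at hb ⊢
    have hb' : f b = 0 := hb
    rw [map_sub, hf, hf, hb', abs_zero, zero_sub] at h1
    exact abs_eq_zero.1 (le_antisymm (by linarith) (abs_nonneg _))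
  ne_top := RingHom.ker_ne_top _
  eq_of_le J hJ hJt hle := by
    refine le_antisymm (fun a ha => ?_) hle
    rw [RingHom.mem_ker]
    by_contra hne
    have h1 : a - algebraMap ℝ A (f a) ∈ J := hle (by simp [RingHom.mem_ker])
    have h2 := J.sub_mem ha h1
    rw [sub_sub_cancel] at h2
    exact const_notMem hJt hne h2

/-- A maximal `ℓ`-ideal from a homomorphism to the reals. -/
def ofHom (f : A →ₐ[ℝ] ℝ) (hf : ∀ a, f |a| = |f a|) : Yosida A :=
  ⟨RingHom.ker f, isMaxLIdeal_ker f hf⟩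

theorem ev_ofHom (f : A →ₐ[ℝ] ℝ) (hf : ∀ a, f |a| = |f a|) (a : A) : ev (ofHom f hf) a = f a :=
  value_eq (show a - algebraMap ℝ A (f a) ∈ RingHom.ker f by simp [RingHom.mem_ker])

theorem ext_ev {x y : Yosida A} (h : ∀ a, ev x a = ev y a) : x = y :=
  Subtype.ext (Ideal.ext fun a => by rw [← ev_eq_zero, ← ev_eq_zero, h])

theorem IsLIdeal.exists_le_max {I : Ideal A} (hI : IsLIdeal I) (hne : I ≠ ⊤) :
    ∃ x : Yosida A, I ≤ x.1 := by
  obtain ⟨M, hIM, hM⟩ := zorn_le_nonempty₀ {J : Ideal A | IsLIdeal J ∧ (1 : A) ∉ J}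
    (fun c hc hchain J hJ => ⟨sSup c, by
      have hmem : ∀ a, a ∈ sSup c ↔ ∃ K ∈ c, a ∈ K := fun a =>
        Submodule.mem_sSup_of_directed ⟨J, hJ⟩ hchain.directedOn
      refine ⟨fun a b hab hb => ?_, fun h => ?_⟩
      · obtain ⟨K, hK, hbK⟩ := (hmem b).1 hb
        exact (hmem a).2 ⟨K, hK, (hc hK).1 a b hab hbK⟩
      · obtain ⟨K, hK, h1⟩ := (hmem 1).1 h
        exact (hc hK).2 h1, fun K hK => le_sSup hK⟩)
    I ⟨hI, fun h => hne ((Ideal.eq_top_iff_one I).2 h)⟩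
  refine ⟨⟨M, hM.prop.1, fun h => hM.prop.2 ((Ideal.eq_top_iff_one M).1 h), fun J hJ hJt hle => ?_⟩,
    hIM⟩
  exact le_antisymm (hM.2 ⟨hJ, fun h => hJt ((Ideal.eq_top_iff_one J).2 h)⟩ hle) hle

/-- Nonnegativity can be tested at the maximal `ℓ`-ideals. -/
theorem nonneg_of_ev {a : A} (h : ∀ x : Yosida A, 0 ≤ ev x a) : 0 ≤ a := by
  have hc : (-a ⊔ 0 : A) ≤ 0 := by
    refine hA.archimedean _ 1 fun n => ?_
    rw [← sub_nonpos]
    set d : A := n • (-a ⊔ 0 : A) - 1 with hd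
    have hprop : adjoinL (⊥ : Ideal A) (-d ⊔ 0) = ⊤ := by
      by_contra hne
      obtain ⟨x, hx⟩ := (adjoinL_isLIdeal _ _).exists_le_max hne
      have h1 := ev_eq_zero.2 (hx (mem_adjoinL _ _))
      rw [ev_pos, map_neg, hd, map_sub, map_nsmul, ev_pos, map_neg, map_one,
        sup_eq_right.2 (neg_nonpos.2 (h x))] at h1
      norm_num at h1
    obtain ⟨m, hm, -, r, hr, h1⟩ : (1 : A) ∈ adjoinL (⊥ : Ideal A) (-d ⊔ 0) :=
      hprop ▸ Submodule.mem_top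
    rw [Ideal.mem_bot] at hm
    rw [hm, zero_add, abs_of_nonneg (le_sup_right : (0 : A) ≤ -d ⊔ 0)] at h1
    have h2 := le_of_const_mul_le hr ((le_abs_self 1).trans h1)
    rw [mul_one] at h2
    obtain ⟨s, hs, h3⟩ := exists_le_const (d ⊔ 0)
    have hpos : (0 : A) ≤ d ⊔ 0 := le_sup_right
    have h4 : algebraMap ℝ A (min 1 (r⁻¹ / s)) * (d ⊔ 0) ≤ 0 := by
      refine (le_inf ?_ ?_).trans (pos_inf_neg d)
      · have := mul_le_mul_of_nonneg_right (const_mono (A := A) (min_le_left 1 (r⁻¹ / s))) hpos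
        simpa using this
      · refine le_trans ?_ h2
        refine (mul_le_mul (const_mono (A := A) (min_le_right 1 (r⁻¹ / s))) h3 hpos
          (const_nonneg (by positivity))).trans (le_of_eq ?_)
        rw [← map_mul, div_mul_cancel₀ _ hs.ne']
    exact le_sup_left.trans (le_of_const_mul_le' (by positivity) h4)
  have := le_sup_left.trans hc
  simpa using this

theorem le_of_ev {a b : A} (h : ∀ x : Yosida A, ev x a ≤ ev x b) : a ≤ b :=
  sub_nonneg.1 (nonneg_of_ev fun x => by rw [map_sub]; linarith [h x])

/-! ### The Yosida space -/

theorem isLIdeal_sInf (S : Set (Ideal A)) (h : ∀ I ∈ S, IsLIdeal I) : IsLIdeal (sInf S) := by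
  intro a b hab hb
  rw [Submodule.mem_sInf] at hb ⊢
  exact fun I hI => h I hI a b hab (hb I hI)

/-- The closed sets of the Yosida space are the sets `{M | I ⊆ M}` for `ℓ`-ideals `I`. -/
instance yosidaTopology : TopologicalSpace (Yosida A) :=
  TopologicalSpace.ofClosed {Z | ∃ I : Ideal A, IsLIdeal I ∧ Z = {x : Yosida A | I ≤ x.1}}
    ⟨⊤, fun _ _ _ _ => Submodule.mem_top, by
      ext x; simpa using x.2.ne_top⟩
    (by
      intro T hT
      refine ⟨sInf {J | IsLIdeal J ∧ ∀ I, IsLIdeal I → {x : Yosida A | I ≤ x.1} ∈ T → I ≤ J},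
        isLIdeal_sInf _ fun J hJ => hJ.1, ?_⟩
      ext x
      simp only [Set.mem_sInter, Set.mem_ofPred_eq]
      constructor
      · intro h
        exact sInf_le ⟨x.2.isLIdeal, fun I _ hI' => h _ hI'⟩
      · intro h Z hZ
        obtain ⟨I, hI, rfl⟩ := hT hZ
        exact (le_sInf fun J hJ => hJ.2 I hI hZ).trans h)
    (by
      rintro _ ⟨I, hI, rfl⟩ _ ⟨J, hJ, rfl⟩
      refine ⟨I ⊓ J, fun a b hab hb => ⟨hI a b hab hb.1, hJ a b hab hb.2⟩, ?_⟩
      ext x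
      simp only [Set.mem_union, Set.mem_ofPred_eq]
      refine ⟨fun h => h.elim (inf_le_left.trans ·) (inf_le_right.trans ·), fun h => ?_⟩
      by_contra hn
      push Not at hn
      obtain ⟨a, haI, hax⟩ := SetLike.not_le_iff_exists.1 hn.1
      obtain ⟨b, hbJ, hbx⟩ := SetLike.not_le_iff_exists.1 hn.2
      have hab : a * b ∈ x.1 := h ⟨I.mul_mem_right _ haI, J.mul_mem_left _ hbJ⟩
      rw [← ev_eq_zero, map_mul, mul_eq_zero, ev_eq_zero, ev_eq_zero] at hab
      exact hab.elim hax hbx)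

theorem isClosed_yosida_iff {Z : Set (Yosida A)} :
    IsClosed Z ↔ ∃ I : Ideal A, IsLIdeal I ∧ Z = {x : Yosida A | I ≤ x.1} :=
  by rw [← isOpen_compl_iff]; change Zᶜᶜ ∈ _ ↔ _; rw [compl_compl]; rfl

theorem isClosed_setOf_subset (S : Set A) : IsClosed {x : Yosida A | S ⊆ x.1} := by
  refine isClosed_yosida_iff.2 ⟨sInf {J | IsLIdeal J ∧ S ⊆ J}, isLIdeal_sInf _ fun J hJ => hJ.1, ?_⟩
  ext x
  constructor
  · intro h
    exact sInf_le (show x.1 ∈ {J : Ideal A | IsLIdeal J ∧ S ⊆ J} from ⟨x.2.isLIdeal, h⟩)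
  · intro h a ha
    exact h (Submodule.mem_sInf.2 fun J hJ => hJ.2 ha)

theorem isClosed_ev_le (a : A) (r : ℝ) : IsClosed {x : Yosida A | ev x a ≤ r} := by
  convert isClosed_setOf_subset {(a - algebraMap ℝ A r) ⊔ 0} using 1
  ext x
  simp only [Set.mem_ofPred_eq, Set.singleton_subset_iff, SetLike.mem_coe]
  rw [← ev_eq_zero, ev_pos, map_sub, ev_const, sup_eq_right, sub_nonpos]

theorem continuous_ev (a : A) : Continuous fun x : Yosida A => ev x a := by
  rw [continuous_iff_lower_upperSemicontinuous, lowerSemicontinuous_iff_isClosed_preimage,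
    upperSemicontinuous_iff_isClosed_preimage]
  refine ⟨fun r => isClosed_ev_le a r, fun r => ?_⟩
  convert isClosed_ev_le (-a) (-r) using 1
  ext x
  simp

theorem isInducing_ev : Topology.IsInducing fun (x : Yosida A) (a : A) => ev x a := by
  have hcont : Continuous fun (x : Yosida A) (a : A) => ev x a :=
    continuous_pi fun a => continuous_ev a
  refine ⟨le_antisymm hcont.le_induced ?_⟩
  intro U hU
  obtain ⟨I, hI, hZ⟩ := isClosed_yosida_iff.1 (isClosed_compl_iff.2 hU)
  refine isOpen_induced_iff.2 ⟨{g | ∀ a ∈ I, g a = 0}ᶜ, ?_, ?_⟩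
  · have : IsClosed (⋂ a ∈ I, {g : A → ℝ | g a = 0}) :=
      isClosed_biInter fun a _ => isClosed_eq (continuous_apply a) continuous_const
    rw [isOpen_compl_iff]
    convert this using 1
    ext g; simp
  · rw [← compl_compl U, hZ]
    ext x
    simp [SetLike.le_def, ← ev_eq_zero]

theorem range_ev : Set.range (fun (x : Yosida A) (a : A) => ev x a) =
    (⋂ (a : A) (b : A), {g : A → ℝ | g (a + b) = g a + g b}) ∩
    (⋂ (a : A) (b : A), {g : A → ℝ | g (a * b) = g a * g b}) ∩
    (⋂ r : ℝ, {g : A → ℝ | g (algebraMap ℝ A r) = r}) ∩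
    (⋂ a : A, {g : A → ℝ | g |a| = |g a|}) := by
  ext g
  simp only [Set.mem_range, Set.mem_inter_iff, Set.mem_iInter, Set.mem_ofPred_eq]
  constructor
  · rintro ⟨x, rfl⟩
    exact ⟨⟨⟨fun a b => map_add _ a b, fun a b => map_mul _ a b⟩, ev_const x⟩, ev_abs x⟩
  · rintro ⟨⟨⟨h1, h2⟩, h3⟩, h4⟩
    let f : A →ₐ[ℝ] ℝ :=
      { toFun := g
        map_one' := by simpa using h3 1
        map_zero' := by simpa using h3 0
        map_add' := h1
        map_mul' := h2
        commutes' := h3 }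
    exact ⟨ofHom f h4, funext fun a => ev_ofHom f h4 a⟩

instance compactSpace_yosida : CompactSpace (Yosida A) := by
  refine ⟨isInducing_ev.isCompact_iff.2 ?_⟩
  rw [Set.image_univ]
  choose n hn0 hn using fun a : A => exists_le_const |a|
  refine IsCompact.of_isClosed_subset
    (isCompact_univ_pi fun a : A => isCompact_Icc (a := -n a) (b := n a)) ?_ ?_
  · rw [range_ev]
    refine ((IsClosed.inter ?_ ?_).inter ?_).inter ?_
    · exact isClosed_iInter fun a => isClosed_iInter fun b => isClosed_eq (by fun_prop) (by fun_prop)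
    · exact isClosed_iInter fun a => isClosed_iInter fun b => isClosed_eq (by fun_prop) (by fun_prop)
    · exact isClosed_iInter fun a => isClosed_eq (by fun_prop) (by fun_prop)
    · exact isClosed_iInter fun a => isClosed_eq (by fun_prop) (by fun_prop)
  · rintro _ ⟨x, rfl⟩ a -
    have := ev_mono x (hn a)
    rw [ev_abs, ev_const] at this
    exact abs_le.1 this

instance t2Space_yosida : T2Space (Yosida A) :=
  T2Space.of_injective_continuous (f := fun (x : Yosida A) (a : A) => ev x a)
    (fun _ _ h => ext_ev fun a => congrFun h a) isInducing_ev.continuous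

/-- Basic neighbourhoods. -/
theorem exists_basic {U : Set (Yosida A)} (hU : IsOpen U) {x : Yosida A} (hx : x ∈ U) :
    ∃ a : A, ev x a < 0 ∧ ∀ y : Yosida A, ev y a < 0 → y ∈ U := by
  obtain ⟨I, hI, hZ⟩ := isClosed_yosida_iff.1 (isClosed_compl_iff.2 hU)
  have hx' : x ∉ {x : Yosida A | I ≤ x.1} := by rw [← hZ]; simpa using hx
  obtain ⟨a, haI, hax⟩ := SetLike.not_le_iff_exists.1 (show ¬ I ≤ x.1 from hx')
  refine ⟨-|a|, ?_, fun y hy => ?_⟩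
  · rw [map_neg, ev_abs, neg_lt_zero, abs_pos]
    exact fun h => hax (ev_eq_zero.1 h)
  · by_contra hyU
    have : y ∈ {x : Yosida A | I ≤ x.1} := by rw [← hZ]; exact hyU
    have h0 := ev_eq_zero.2 (this haI)
    rw [map_neg, ev_abs, h0] at hy
    simp at hy

theorem totallyDisconnected_yosida (hc : IsCleanRing A) : TotallyDisconnectedSpace (Yosida A) := by
  refine @TotallySeparatedSpace.totallyDisconnectedSpace _ _
    (totallySeparatedSpace_iff_exists_isClopen.2 fun x y hxy => ?_)
  obtain ⟨a, ha⟩ : ∃ a, ev x a ≠ ev y a := by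
    by_contra h; push Not at h; exact hxy (ext_ev h)
  let b : A := algebraMap ℝ A (ev y a - ev x a)⁻¹ * (a - algebraMap ℝ A (ev x a))
  obtain ⟨e, v, he, hv, hb⟩ := hc b
  have hbx : ev x b = 0 := by simp [b]
  have hby : ev y b = 1 := by
    simp only [b, map_mul, map_sub, ev_const]
    exact inv_mul_cancel₀ (sub_ne_zero.2 ha.symm)
  have hval : ∀ z : Yosida A, ev z e = 0 ∨ ev z e = 1 := fun z =>
    IsIdempotentElem.iff_eq_zero_or_one.1 (he.map (ev z))
  have hv0 : ∀ z : Yosida A, ev z v ≠ 0 := fun z => (hv.map (ev z)).ne_zero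
  have hx1 : ev x e = 1 := by
    rcases hval x with h | h
    · rw [hb, map_add, h, zero_add] at hbx
      exact absurd hbx (hv0 x)
    · exact h
  have hy0 : ev y e = 0 := by
    rcases hval y with h | h
    · exact h
    · rw [hb, map_add, h] at hby
      exact absurd (by linarith) (hv0 y)
  refine ⟨{z | ev z e = 1}, ⟨isClosed_eq (continuous_ev e) continuous_const, ?_⟩, hx1, ?_⟩
  · convert isOpen_lt (continuous_const (y := (1 / 2 : ℝ))) (continuous_ev e) using 1
    ext z
    simp only [Set.mem_ofPred_eq]
    rcases hval z with h | h <;> rw [h] <;> norm_num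
  · simp [hy0]

end Bal
/-! ### Continuous relations and bounded morphisms -/

/-- The preimage `R⁻¹[U] = {x | ∃ y ∈ U, x R y}`. -/
def relPre {X : Type*} (R : X → X → Prop) (U : Set X) : Set X := {x | ∃ y ∈ U, R x y}

/-- A continuous relation on a topological space. -/
structure IsContRel {X : Type*} [TopologicalSpace X] (R : X → X → Prop) : Prop where
  isClosed_image : ∀ x : X, IsClosed {y | R x y}
  isClosed_preimage : ∀ F : Set X, IsClosed F → IsClosed (relPre R F)
  isOpen_preimage : ∀ U : Set X, IsOpen U → IsOpen (relPre R U)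

/-- A bounded morphism of Kripke frames: `f(R[x]) = S[f(x)]`. -/
def IsBddMorphism {X Y : Type*} (R : X → X → Prop) (S : Y → Y → Prop) (f : X → Y) : Prop :=
  ∀ x : X, f '' {y | R x y} = {z | S (f x) z}

/-- On a compact space, a closed relation has closed preimages of closed sets. -/
theorem isClosed_relPre {X : Type*} [TopologicalSpace X] [CompactSpace X] {R : X → X → Prop}
    (hR : IsClosed {p : X × X | R p.1 p.2}) {F : Set X} (hF : IsClosed F) :
    IsClosed (relPre R F) := by
  have h := isClosedMap_fst_of_compactSpace (X := X) (Y := X) _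
    (hR.inter (hF.preimage continuous_snd))
  convert h using 1
  ext x
  simp [relPre, and_comm]

/-! ### The dual relation on the Yosida space -/

/-- `x R y` iff `□ a ∈ x` for all `a ∈ y` with `a ≥ 0`. -/
def yosidaRel {A : Type*} [CommRing A] [Lattice A] (box : A → A) (x y : Yosida A) : Prop :=
  ∀ a : A, 0 ≤ a → a ∈ y.1 → box a ∈ x.1

section YosidaRel

variable {A : Type*} [CommRing A] [Lattice A] [Algebra ℝ A] [hA : IsBal A] {box : A → A}

theorem IsModalOp.mono (hb : IsModalOp box) {a b : A} (h : a ≤ b) : box a ≤ box b := by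
  rw [← inf_eq_left.2 h, hb.map_inf]; exact inf_le_right

theorem IsModalOp.box_one (hb : IsModalOp box) : box 1 = 1 := by
  have := hb.map_const 1
  simpa using this

theorem IsModalOp.zero_mul_box (hb : IsModalOp box) (a : A) : box 0 * box a = box 0 := by
  have := hb.map_const_mul 0 a le_rfl
  simpa using this.symm

theorem IsModalOp.zero_nonneg (hb : IsModalOp box) : 0 ≤ box 0 := by
  have := hb.map_pos 0
  rw [sup_idem] at this
  rw [this]; exact le_sup_right

theorem IsModalOp.ev_zero (hb : IsModalOp box) (x : Yosida A) :
    ev x (box 0) = 0 ∨ ev x (box 0) = 1 :=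
  IsIdempotentElem.iff_eq_zero_or_one.1 ((show IsIdempotentElem (box 0) from
    hb.zero_mul_box 0).map (ev x))

theorem IsModalOp.ev_add_const (hb : IsModalOp box) {x : Yosida A} (hx : ev x (box 0) = 0) (a : A)
    (r : ℝ) : ev x (box (a + algebraMap ℝ A r)) = ev x (box a) + r := by
  rw [hb.map_add_const, hb.map_const]
  simp only [map_sub, map_add, map_mul, ev_const, hx]; ring

theorem IsModalOp.ev_const_mul (hb : IsModalOp box) {x : Yosida A} (hx : ev x (box 0) = 0) (a : A)
    {r : ℝ} (hr : 0 ≤ r) : ev x (box (algebraMap ℝ A r * a)) = r * ev x (box a) := by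
  rw [hb.map_const_mul _ _ hr, hb.map_const]
  simp only [map_add, map_mul, ev_const, hx]; ring

theorem yosidaRel_iff (hb : IsModalOp box) (x y : Yosida A) :
    yosidaRel box x y ↔ ev x (box 0) = 0 ∧ ∀ a, ev x (box a) ≤ ev y a := by
  constructor
  · intro h
    have h0 : ev x (box 0) = 0 := ev_eq_zero.2 (h 0 le_rfl y.1.zero_mem)
    refine ⟨h0, fun a => ?_⟩
    have h1 := h ((a + algebraMap ℝ A (-ev y a)) ⊔ 0) le_sup_right (by
      rw [← ev_eq_zero, ev_pos, map_add, ev_const]; simp)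
    rw [← ev_eq_zero, hb.map_pos, ev_pos, hb.ev_add_const h0, sup_eq_right] at h1
    linarith
  · rintro ⟨h0, h⟩ a ha hay
    have h1 := h a
    rw [ev_eq_zero.2 hay] at h1
    have h2 := ev_mono x (hb.mono ha)
    rw [h0] at h2
    exact ev_eq_zero.1 (le_antisymm h1 h2)

/-- The value of `□ a` at `x` is attained by `a` on `R[x]`. -/
theorem IsModalOp.exists_attains (hb : IsModalOp box) {x : Yosida A} (hx : ev x (box 0) = 0)
    (a : A) : ∃ y, yosidaRel box x y ∧ ev y a ≤ ev x (box a) := by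
  classical
  by_contra hcon
  push Not at hcon
  set N : A → A := fun c => c + algebraMap ℝ A (-ev x (box c)) with hN
  have hN0 : ∀ c, ev x (box (N c)) = 0 := fun c => by
    rw [hN]; simp only; rw [hb.ev_add_const hx]; ring
  have hNy : ∀ c y, ev y (N c) = ev y c - ev x (box c) := fun c y => by
    rw [hN]; simp only [map_add, ev_const]; ring
  have hcov : (Set.univ : Set (Yosida A)) ⊆
      ⋃ o : Option A, o.elim {y | 0 < ev y (N a)} fun c => {y | ev y (N c) < 0} := by
    intro y _
    rw [Set.mem_iUnion]
    by_cases hy : ∀ c, ev x (box c) ≤ ev y c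
    · refine ⟨none, ?_⟩
      have := hcon y ((yosidaRel_iff hb x y).2 ⟨hx, hy⟩)
      change 0 < ev y (N a)
      rw [hNy]; linarith
    · push Not at hy
      obtain ⟨c, hc⟩ := hy
      refine ⟨some c, ?_⟩
      change ev y (N c) < 0
      rw [hNy]; linarith
  obtain ⟨t, ht⟩ := isCompact_univ.elim_finite_subcover _ (fun o => by
    cases o with
    | none => exact isOpen_lt continuous_const (continuous_ev _)
    | some c => exact isOpen_lt (continuous_ev _) continuous_const) hcov
  obtain ⟨b, hb0, hbt⟩ : ∃ b : A, ev x (box b) = 0 ∧ ∀ c, some c ∈ t → ∀ y, ev y b ≤ ev y (N c) := by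
    clear ht
    induction t using Finset.induction_on with
    | empty => exact ⟨0, hx, by simp⟩
    | insert o t hot ih =>
      obtain ⟨b, h1, h2⟩ := ih
      cases o with
      | none =>
        refine ⟨b, h1, fun c hc y => h2 c ?_ y⟩
        simpa using hc
      | some d =>
        refine ⟨b ⊓ N d, ?_, fun c hc y => ?_⟩
        · rw [hb.map_inf, ev_inf, h1, hN0, inf_idem]
        · rw [ev_inf]
          rcases Finset.mem_insert.1 hc with h | h
          · rw [Option.some.injEq] at h
            rw [h]; exact inf_le_right
          · exact inf_le_left.trans (h2 c h y)
  have hsep : ∀ y : Yosida A, ev y b < 0 ∨ 0 < ev y (N a) := by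
    intro y
    obtain ⟨o, ho, hy⟩ := Set.mem_iUnion₂.1 (ht (Set.mem_univ y))
    cases o with
    | none => exact Or.inr hy
    | some c => exact Or.inl ((hbt c ho y).trans_lt hy)
  -- a uniform separation constant
  obtain ⟨δ, hδ, hδy⟩ : ∃ δ : ℝ, 0 < δ ∧ ∀ y : Yosida A, δ ≤ max (-ev y b) (ev y (N a)) := by
    have hc : Continuous fun y : Yosida A => max (-ev y b) (ev y (N a)) :=
      (continuous_ev b).neg.max (continuous_ev (N a))
    obtain ⟨y, -, hy⟩ := isCompact_univ.exists_isMinOn ⟨x, Set.mem_univ x⟩ hc.continuousOn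
    refine ⟨_, ?_, fun z => hy (Set.mem_univ z)⟩
    rcases hsep y with h | h
    · exact lt_max_of_lt_left (by linarith)
    · exact lt_max_of_lt_right h
  obtain ⟨s, hs, hbs⟩ := exists_le_const b
  have hle : b + algebraMap ℝ A δ ≤ algebraMap ℝ A ((s + δ) / δ) * (N a ⊔ 0) := by
    refine le_of_ev fun y => ?_
    have h1 := ev_mono y hbs
    rw [map_add, map_mul, ev_const, ev_const, ev_pos]
    rw [ev_const] at h1
    have h2 : 0 ≤ (s + δ) / δ := by positivity
    rcases le_max_iff.1 (hδy y) with h | h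
    · have : 0 ≤ (s + δ) / δ * (ev y (N a) ⊔ 0) := mul_nonneg h2 le_sup_right
      linarith
    · have : (s + δ) / δ * δ ≤ (s + δ) / δ * (ev y (N a) ⊔ 0) :=
        mul_le_mul_of_nonneg_left (h.trans le_sup_left) h2
      rw [div_mul_cancel₀ _ hδ.ne'] at this
      linarith
  have h3 := ev_mono x (hb.mono hle)
  rw [hb.ev_add_const hx, hb0, hb.ev_const_mul hx _ (by positivity), hb.map_pos, ev_pos, hN0,
    sup_idem, mul_zero, zero_add] at h3
  linarith

theorem isContRel_yosidaRel (hb : IsModalOp box) : IsContRel (yosidaRel box) := by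
  have hR : IsClosed {p : Yosida A × Yosida A | yosidaRel box p.1 p.2} := by
    have : {p : Yosida A × Yosida A | yosidaRel box p.1 p.2} =
        {p | ev p.1 (box 0) = 0} ∩ ⋂ a, {p | ev p.1 (box a) ≤ ev p.2 a} := by
      ext p; simp [yosidaRel_iff hb]
    rw [this]
    exact (isClosed_eq ((continuous_ev _).comp continuous_fst) continuous_const).inter
      (isClosed_iInter fun a => isClosed_le ((continuous_ev _).comp continuous_fst)
        ((continuous_ev _).comp continuous_snd))
  refine ⟨fun x => ?_, fun F hF => isClosed_relPre hR hF, fun U hU => ?_⟩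
  · exact hR.preimage (Continuous.prodMk_right x)
  · rw [isOpen_iff_forall_mem_open]
    rintro x ⟨y, hyU, hxy⟩
    obtain ⟨a, hay, haU⟩ := exists_basic hU hyU
    obtain ⟨hx0, hxa⟩ := (yosidaRel_iff hb x y).1 hxy
    refine ⟨{z | ev z (box a) < 0} ∩ {z | ev z (box 0) < 1}, ?_, ?_, ?_, ?_⟩
    · rintro z ⟨hz1, hz2⟩
      have hz0 : ev z (box 0) = 0 := (hb.ev_zero z).resolve_right (ne_of_lt hz2)
      obtain ⟨w, hzw, hw⟩ := hb.exists_attains hz0 a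
      exact ⟨w, haU w (hw.trans_lt hz1), hzw⟩
    · exact (isOpen_lt (continuous_ev _) continuous_const).inter
        (isOpen_lt (continuous_ev _) continuous_const)
    · exact (hxa a).trans_lt hay
    · change ev x (box 0) < 1
      rw [hx0]; exact one_pos

end YosidaRel

section YosidaMap

variable {A B : Type*} [CommRing A] [Lattice A] [Algebra ℝ A] [hA : IsBal A]
  [CommRing B] [Lattice B] [Algebra ℝ B] [hB : IsBal B]

theorem isMaxLIdeal_comap (f : A →ₐ[ℝ] B) (hf : ∀ a, f |a| = |f a|) {M : Ideal B}
    (hM : IsMaxLIdeal M) : IsMaxLIdeal (M.comap f) := by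
  let x : Yosida B := ⟨M, hM⟩
  have h := isMaxLIdeal_ker ((ev x).comp f) fun a => by
    simp only [AlgHom.comp_apply]; rw [hf, ev_abs]
  convert h using 1
  ext a
  simp only [Ideal.mem_comap, RingHom.mem_ker]
  exact (ev_eq_zero (x := x)).symm

/-- The inverse image map `M ↦ f⁻¹(M)` on maximal `ℓ`-ideals. -/
def yosidaMap (f : A →ₐ[ℝ] B) (hf : ∀ a, f |a| = |f a|) (x : Yosida B) : Yosida A :=
  ⟨x.1.comap f, isMaxLIdeal_comap f hf x.2⟩

theorem ev_yosidaMap (f : A →ₐ[ℝ] B) (hf : ∀ a, f |a| = |f a|) (x : Yosida B) (a : A) :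
    ev (yosidaMap f hf x) a = ev x (f a) := by
  refine value_eq ?_
  change f (a - algebraMap ℝ A (ev x (f a))) ∈ x.1
  rw [map_sub, AlgHom.commutes]
  exact value_spec x (f a)

theorem continuous_yosidaMap (f : A →ₐ[ℝ] B) (hf : ∀ a, f |a| = |f a|) :
    Continuous (yosidaMap f hf) := by
  rw [isInducing_ev.continuous_iff]
  refine continuous_pi fun a => ?_
  simp only [Function.comp_def, ev_yosidaMap]
  exact continuous_ev (f a)

theorem isBddMorphism_yosidaMap {box : A → A} {box' : B → B} (hb : IsModalOp box)
    (hb' : IsModalOp box') (f : A →ₐ[ℝ] B) (hf : ∀ a, f |a| = |f a|)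
    (hbox : ∀ a, f (box a) = box' (f a)) :
    IsBddMorphism (yosidaRel box') (yosidaRel box) (yosidaMap f hf) := by
  intro x
  apply subset_antisymm
  · rintro _ ⟨y, hxy, rfl⟩
    rw [Set.mem_ofPred_eq, yosidaRel_iff hb']  at hxy
    rw [Set.mem_ofPred_eq, yosidaRel_iff hb]
    simp only [ev_yosidaMap, hbox, map_zero]
    exact ⟨hxy.1, fun a => hxy.2 _⟩
  · intro z hz
    rw [Set.mem_ofPred_eq, yosidaRel_iff hb] at hz
    simp only [ev_yosidaMap, hbox, map_zero] at hz
    by_contra hzn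
    have hcl : IsClosed (yosidaMap f hf '' {y | yosidaRel box' x y}) :=
      (((isContRel_yosidaRel hb').isClosed_image x).isCompact.image
        (continuous_yosidaMap f hf)).isClosed
    obtain ⟨a, haz, ha⟩ := exists_basic hcl.isOpen_compl hzn
    obtain ⟨y, hxy, hy⟩ := hb'.exists_attains hz.1 (f a)
    have h1 := hz.2 a
    refine ha (yosidaMap f hf y) ?_ ⟨y, hxy, rfl⟩
    rw [ev_yosidaMap]
    linarith

end YosidaMap

/-! ### The modal operator on continuous functions -/

section BoxFun

variable {X : Type*} {R : X → X → Prop}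

open Classical in
/-- `(□_R f)(x) = inf f(R[x])` if `R[x] ≠ ∅`, and `(□_R f)(x) = 1` otherwise. -/
noncomputable def boxFun (R : X → X → Prop) (f : X → ℝ) (x : X) : ℝ :=
  if {y | R x y}.Nonempty then sInf (f '' {y | R x y}) else 1

theorem boxFun_of_empty {f : X → ℝ} {x : X} (h : ¬ ∃ y, R x y) : boxFun R f x = 1 :=
  if_neg h

variable [TopologicalSpace X] [CompactSpace X]

theorem exists_boxFun (hR : IsContRel R) {f : X → ℝ} (hf : Continuous f) {x : X} (h : ∃ y, R x y) :
    ∃ y, R x y ∧ boxFun R f x = f y ∧ ∀ z, R x z → f y ≤ f z := by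
  obtain ⟨y, hy, hmin⟩ := (hR.isClosed_image x).isCompact.exists_isMinOn h hf.continuousOn
  refine ⟨y, hy, ?_, fun z hz => hmin hz⟩
  rw [boxFun, if_pos (show {y | R x y}.Nonempty from h)]
  exact IsLeast.csInf_eq ⟨⟨y, hy, rfl⟩, by rintro _ ⟨z, hz, rfl⟩; exact hmin hz⟩

theorem boxFun_eq (hR : IsContRel R) {f : X → ℝ} (hf : Continuous f) {x y : X} (hy : R x y)
    (h : ∀ z, R x z → f y ≤ f z) : boxFun R f x = f y := by
  obtain ⟨w, hw, he, hmin⟩ := exists_boxFun hR hf ⟨y, hy⟩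
  rw [he]
  exact le_antisymm (hmin y hy) (h w hw)

theorem continuous_boxFun (hR : IsContRel R) {f : X → ℝ} (hf : Continuous f) : Continuous (boxFun R f) := by
  have hD : IsClopen (relPre R Set.univ) :=
    ⟨hR.isClosed_preimage _ isClosed_univ, hR.isOpen_preimage _ isOpen_univ⟩
  have hDx : ∀ x, x ∈ relPre R Set.univ ↔ ∃ y, R x y := fun x => by simp [relPre]
  rw [continuous_iff_lower_upperSemicontinuous, lowerSemicontinuous_iff_isClosed_preimage,
    upperSemicontinuous_iff_isOpen_preimage]
  refine ⟨fun r => ?_, fun r => ?_⟩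
  · have : boxFun R f ⁻¹' Set.Iic r = relPre R (f ⁻¹' Set.Iic r) ∪
        ((relPre R Set.univ)ᶜ ∩ {_x | 1 ≤ r}) := by
      ext x
      by_cases hx : ∃ y, R x y
      · obtain ⟨y, hy, he, hmin⟩ := exists_boxFun hR hf hx
        simp only [Set.mem_preimage, Set.mem_Iic, Set.mem_union, Set.mem_inter_iff,
          Set.mem_compl_iff, hDx, hx, not_true, false_and, or_false, he]
        exact ⟨fun h => ⟨y, h, hy⟩, fun ⟨z, hz, hxz⟩ => (hmin z hxz).trans hz⟩
      · simp only [Set.mem_preimage, Set.mem_Iic, Set.mem_union, Set.mem_inter_iff,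
          Set.mem_compl_iff, hDx, hx, not_false_iff, true_and, boxFun_of_empty hx]
        refine ⟨Or.inr, fun h => h.elim (fun ⟨z, _, hz⟩ => absurd ⟨z, hz⟩ hx) id⟩
    rw [this]
    exact (hR.isClosed_preimage _ (isClosed_Iic.preimage hf)).union
      (hD.compl.isClosed.inter isClosed_const)
  · have : boxFun R f ⁻¹' Set.Iio r = relPre R (f ⁻¹' Set.Iio r) ∪
        ((relPre R Set.univ)ᶜ ∩ {_x | 1 < r}) := by
      ext x
      by_cases hx : ∃ y, R x y
      · obtain ⟨y, hy, he, hmin⟩ := exists_boxFun hR hf hx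
        simp only [Set.mem_preimage, Set.mem_Iio, Set.mem_union, Set.mem_inter_iff,
          Set.mem_compl_iff, hDx, hx, not_true, false_and, or_false, he]
        exact ⟨fun h => ⟨y, h, hy⟩, fun ⟨z, hz, hxz⟩ => (hmin z hxz).trans_lt hz⟩
      · simp only [Set.mem_preimage, Set.mem_Iio, Set.mem_union, Set.mem_inter_iff,
          Set.mem_compl_iff, hDx, hx, not_false_iff, true_and, boxFun_of_empty hx]
        refine ⟨Or.inr, fun h => h.elim (fun ⟨z, _, hz⟩ => absurd ⟨z, hz⟩ hx) id⟩
    rw [this]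
    exact (hR.isOpen_preimage _ (isOpen_Iio.preimage hf)).union
      (hD.compl.isOpen.inter isOpen_const)

/-- The operator `□_R` on `C(X)`. -/
noncomputable def boxC (hR : IsContRel R) (f : C(X, ℝ)) : C(X, ℝ) :=
  ⟨boxFun R f, continuous_boxFun hR f.continuous⟩

theorem isModalOp_boxC (hR : IsContRel R) : IsModalOp (boxC hR) := by
  constructor
  · intro f g
    ext x
    change boxFun R ⇑(f ⊓ g) x = boxFun R f x ⊓ boxFun R g x
    by_cases hx : ∃ y, R x y
    · obtain ⟨y, hy, he, hmin⟩ := exists_boxFun hR f.continuous hx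
      obtain ⟨z, hz, he', hmin'⟩ := exists_boxFun hR g.continuous hx
      obtain ⟨w, hw, he'', hmin''⟩ := exists_boxFun hR (f ⊓ g).continuous hx
      rw [he, he', he'']
      apply le_antisymm
      · exact le_inf ((hmin'' y hy).trans inf_le_left) ((hmin'' z hz).trans inf_le_right)
      · exact inf_le_inf (hmin w hw) (hmin' w hw)
    · simp only [boxFun_of_empty hx, inf_idem]
  · intro r
    ext x
    change boxFun R (fun _ => r) x = r + (1 - r) * boxFun R (fun _ => 0) x
    by_cases hx : ∃ y, R x y
    · obtain ⟨y, hy⟩ := hx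
      rw [boxFun_eq hR continuous_const hy fun _ _ => le_rfl,
        boxFun_eq hR continuous_const hy fun _ _ => le_rfl]
      ring
    · simp only [boxFun_of_empty hx]; ring
  · intro f
    ext x
    change boxFun R (fun x => f x ⊔ 0) x = boxFun R f x ⊔ 0
    by_cases hx : ∃ y, R x y
    · obtain ⟨y, hy, he, hmin⟩ := exists_boxFun hR f.continuous hx
      rw [boxFun_eq hR (by fun_prop) hy fun z hz => sup_le_sup_right (hmin z hz) 0, he]
    · simp [boxFun_of_empty hx]
  · intro f r
    ext x
    change boxFun R (fun x => f x + r) x =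
      boxFun R f x + boxFun R (fun _ => r) x - boxFun R (fun _ => 0) x
    by_cases hx : ∃ y, R x y
    · obtain ⟨y, hy, he, hmin⟩ := exists_boxFun hR f.continuous hx
      rw [boxFun_eq hR continuous_const hy fun _ _ => le_rfl,
        boxFun_eq hR continuous_const hy fun _ _ => le_rfl,
        boxFun_eq hR (by fun_prop) hy fun z hz => by linarith [hmin z hz], he]
      ring
    · simp [boxFun_of_empty hx]
  · intro r f hr
    ext x
    change boxFun R (fun x => r * f x) x = boxFun R (fun _ => r) x * boxFun R f x
    by_cases hx : ∃ y, R x y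
    · obtain ⟨y, hy, he, hmin⟩ := exists_boxFun hR f.continuous hx
      rw [boxFun_eq hR continuous_const hy fun _ _ => le_rfl,
        boxFun_eq hR (by fun_prop) hy fun z hz => mul_le_mul_of_nonneg_left (hmin z hz) hr, he]
    · simp [boxFun_of_empty hx]

end BoxFun

section CX

variable (X : Type*) [TopologicalSpace X] [CompactSpace X]

instance isBal_continuousMap : IsBal C(X, ℝ) where
  add_le_add f g h hfg x := add_le_add_left (hfg x) (h x)
  mul_nonneg f g hf hg x := mul_nonneg (hf x) (hg x)
  smul_nonneg r f hr hf x := mul_nonneg hr (hf x)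
  bounded f := by
    obtain ⟨n, hn⟩ := exists_nat_ge ‖f‖
    refine ⟨n, fun x => ?_⟩
    have : (n • (1 : C(X, ℝ))) x = n := by simp
    change f x ≤ (n • (1 : C(X, ℝ))) x
    rw [this]
    exact (le_abs_self _).trans ((f.norm_coe_le_norm x).trans hn)
  archimedean f g h x := by
    change f x ≤ 0
    by_contra! hlt
    obtain ⟨n, hn⟩ := Archimedean.arch (g x + 1) hlt
    have h1 : n • f x ≤ g x := h n x
    linarith

theorem unifNorm_continuousMap (f : C(X, ℝ)) : unifNorm f = ‖f‖ := by
  have hS : ∀ r : ℝ, |f| ≤ algebraMap ℝ C(X, ℝ) r ↔ ∀ x, ‖f x‖ ≤ r := fun r => Iff.rfl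
  rw [unifNorm]
  rcases isEmpty_or_nonempty X with hX | hX
  · have : {r : ℝ | |f| ≤ algebraMap ℝ C(X, ℝ) r} = Set.univ := by
      ext r; simp
    rw [this, Real.sInf_univ, Subsingleton.elim f 0, norm_zero]
  · refine IsLeast.csInf_eq ⟨?_, ?_⟩
    · exact (hS _).2 fun x => f.norm_coe_le_norm x
    · intro r hr
      exact (ContinuousMap.norm_le_of_nonempty f).2 ((hS r).1 hr)

theorem isUnifComplete_continuousMap : IsUnifComplete C(X, ℝ) := by
  intro s hs
  simp only [unifNorm_continuousMap] at hs ⊢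
  have : CauchySeq s := Metric.cauchySeq_iff.2 fun ε hε => by
    obtain ⟨N, hN⟩ := hs ε hε
    exact ⟨N, fun m hm n hn => by rw [dist_eq_norm]; exact hN m hm n hn⟩
  obtain ⟨a, ha⟩ := cauchySeq_tendsto_of_complete this
  refine ⟨a, fun ε hε => ?_⟩
  obtain ⟨N, hN⟩ := Metric.tendsto_atTop.1 ha ε hε
  exact ⟨N, fun n hn => by rw [← dist_eq_norm]; exact hN n hn⟩

theorem isCleanRing_continuousMap [T2Space X] [TotallyDisconnectedSpace X] :
    IsCleanRing C(X, ℝ) := by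
  classical
  intro f
  obtain ⟨U, hU, h0, h1⟩ := exists_clopen_of_closed_subset_open
    (Z := f ⁻¹' {0}) (U := (f ⁻¹' {1})ᶜ) (isClosed_singleton.preimage f.continuous)
    (isClosed_singleton.preimage f.continuous).isOpen_compl (by
      intro x hx hx1
      simp only [Set.mem_preimage, Set.mem_singleton_iff] at hx hx1
      rw [hx] at hx1; norm_num at hx1)
  let e : C(X, ℝ) := ⟨U.indicator fun _ => 1, (IsClopen.continuous_indicator hU continuous_const)⟩
  have he : ∀ x, e x = if x ∈ U then 1 else 0 := fun x => by simp [e, Set.indicator_apply]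
  refine ⟨e, f - e, ?_, ?_, by ring⟩
  · ext x
    change e x * e x = e x
    rw [he]; split_ifs <;> simp
  · rw [ContinuousMap.isUnit_iff_forall_ne_zero]
    intro x
    change f x - e x ≠ 0
    rw [he]
    split_ifs with hx
    · intro h
      exact h1 hx (by simpa using sub_eq_zero.1 h)
    · intro h
      exact hx (h0 (by simpa using h))

end CX

theorem boxFun_comp {X Y : Type*} {R : X → X → Prop} {S : Y → Y → Prop} {φ : X → Y}
    (hφ : IsBddMorphism R S φ) (f : Y → ℝ) (x : X) :
    boxFun R (f ∘ φ) x = boxFun S f (φ x) := by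
  have h := hφ x
  rw [boxFun, boxFun, ← h, Set.image_image, Set.image_nonempty]
  rfl

/-! ### Idempotents -/

/-- The boolean algebra of idempotents, with `e ⊓ f = e * f`, `e ⊔ f = e + f - e * f` and
`eᶜ = 1 - e`. -/
def Idem (A : Type*) [CommRing A] : Type _ := {a : A // IsIdempotentElem a}

instance idemBooleanAlgebra (A : Type*) [CommRing A] : BooleanAlgebra (Idem A) :=
  inferInstanceAs (BooleanAlgebra {a : A // IsIdempotentElem a})

theorem idem_inf {A : Type*} [CommRing A] (e f : Idem A) : (e ⊓ f).1 = e.1 * f.1 := rfl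
theorem idem_sup {A : Type*} [CommRing A] (e f : Idem A) : (e ⊔ f).1 = e.1 + f.1 - e.1 * f.1 := rfl
theorem idem_top {A : Type*} [CommRing A] : (⊤ : Idem A).1 = 1 := rfl
theorem idem_bot {A : Type*} [CommRing A] : (⊥ : Idem A).1 = 0 := rfl
theorem idem_compl {A : Type*} [CommRing A] (e : Idem A) : (eᶜ).1 = 1 - e.1 := rfl

section IdemBox

variable {A : Type*} [CommRing A] [Lattice A] [Algebra ℝ A] [hA : IsBal A] {box : A → A}

theorem eq_of_ev {a b : A} (h : ∀ x : Yosida A, ev x a = ev x b) : a = b :=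
  le_antisymm (le_of_ev fun x => (h x).le) (le_of_ev fun x => (h x).ge)

theorem ev_idem (x : Yosida A) {e : A} (he : IsIdempotentElem e) : ev x e = 0 ∨ ev x e = 1 :=
  IsIdempotentElem.iff_eq_zero_or_one.1 (he.map (ev x))

theorem mul_eq_inf {e f : A} (he : IsIdempotentElem e) (hf : IsIdempotentElem f) :
    e * f = e ⊓ f := by
  refine eq_of_ev fun x => ?_
  rw [map_mul, ev_inf]
  rcases ev_idem x he with h | h <;> rcases ev_idem x hf with h' | h' <;> rw [h, h'] <;> norm_num

theorem IsModalOp.ev_box_of_one (hb : IsModalOp box) {x : Yosida A} (hx : ev x (box 0) = 1)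
    (a : A) : ev x (box a) = 1 := by
  have h := congrArg (ev x) (hb.zero_mul_box a)
  rwa [map_mul, hx, one_mul] at h

theorem IsModalOp.isIdempotentElem (hb : IsModalOp box) {e : A} (he : IsIdempotentElem e) :
    IsIdempotentElem (box e) := by
  refine eq_of_ev fun x => ?_
  rw [map_mul]
  have key : ev x (box e) = 0 ∨ ev x (box e) = 1 := by
    rcases hb.ev_zero x with hx | hx
    · have h2 : e = (algebraMap ℝ A 2 * e) ⊓ 1 := by
        refine eq_of_ev fun y => ?_
        rw [ev_inf, map_mul, ev_const, map_one]
        rcases ev_idem y he with h | h <;> rw [h] <;> norm_num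
      have h3 := congrArg (fun a => ev x (box a)) h2
      simp only [hb.map_inf, ev_inf, hb.box_one, map_one] at h3
      rw [hb.ev_const_mul hx _ (by norm_num)] at h3
      rcases le_total (2 * ev x (box e)) 1 with h | h
      · rw [inf_eq_left.2 h] at h3; left; linarith
      · rw [inf_eq_right.2 h] at h3; right; exact h3
    · exact Or.inr (hb.ev_box_of_one hx e)
  rcases key with h | h <;> rw [h] <;> norm_num

end IdemBox

/-! ### Ultrafilters of a boolean algebra -/

/-- An ultrafilter of a boolean algebra. -/
structure BAUltrafilter (A : Type*) [BooleanAlgebra A] where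
  carrier : Set A
  top_mem : ⊤ ∈ carrier
  bot_notMem : ⊥ ∉ carrier
  inf_mem : ∀ a b : A, a ∈ carrier → b ∈ carrier → a ⊓ b ∈ carrier
  mem_of_le : ∀ a b : A, a ≤ b → a ∈ carrier → b ∈ carrier
  mem_or_compl_mem : ∀ a : A, a ∈ carrier ∨ aᶜ ∈ carrier

namespace BAUltrafilter

variable {A : Type*} [BooleanAlgebra A]

theorem ext' {x y : BAUltrafilter A} (h : ∀ a, a ∈ x.carrier ↔ a ∈ y.carrier) : x = y := by
  cases x; cases y; congr; exact Set.ext h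

theorem compl_mem_iff (x : BAUltrafilter A) (a : A) : aᶜ ∈ x.carrier ↔ a ∉ x.carrier :=
  ⟨fun h h' => x.bot_notMem (by simpa using x.inf_mem _ _ h' h),
    fun h => (x.mem_or_compl_mem a).resolve_left h⟩

theorem inf_mem_iff (x : BAUltrafilter A) (a b : A) :
    a ⊓ b ∈ x.carrier ↔ a ∈ x.carrier ∧ b ∈ x.carrier :=
  ⟨fun h => ⟨x.mem_of_le _ _ inf_le_left h, x.mem_of_le _ _ inf_le_right h⟩,
    fun h => x.inf_mem _ _ h.1 h.2⟩

/-- The topology with basis the sets `{x | a ∈ x}`. -/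
instance : TopologicalSpace (BAUltrafilter A) :=
  TopologicalSpace.generateFrom {U | ∃ a : A, U = {x | a ∈ x.carrier}}

theorem isOpen_mem (a : A) : IsOpen {x : BAUltrafilter A | a ∈ x.carrier} :=
  TopologicalSpace.isOpen_generateFrom_of_mem ⟨a, rfl⟩

theorem isClopen_mem (a : A) : IsClopen {x : BAUltrafilter A | a ∈ x.carrier} := by
  refine ⟨⟨?_⟩, isOpen_mem a⟩
  convert isOpen_mem aᶜ using 1
  ext x
  exact (x.compl_mem_iff a).symm

theorem exists_basic {U : Set (BAUltrafilter A)} (hU : IsOpen U) {x : BAUltrafilter A}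
    (hx : x ∈ U) : ∃ a ∈ x.carrier, ∀ y : BAUltrafilter A, a ∈ y.carrier → y ∈ U := by
  induction hU with
  | basic s hs => obtain ⟨a, rfl⟩ := hs; exact ⟨a, hx, fun _ h => h⟩
  | univ => exact ⟨⊤, x.top_mem, fun _ _ => trivial⟩
  | inter s t _ _ hs ht =>
    obtain ⟨a, ha, ha'⟩ := hs hx.1
    obtain ⟨b, hb, hb'⟩ := ht hx.2
    exact ⟨a ⊓ b, x.inf_mem _ _ ha hb, fun y hy =>
      ⟨ha' y ((y.inf_mem_iff _ _).1 hy).1, hb' y ((y.inf_mem_iff _ _).1 hy).2⟩⟩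
  | sUnion S _ ih =>
    obtain ⟨s, hs, hxs⟩ := hx
    obtain ⟨a, ha, ha'⟩ := ih s hs hxs
    exact ⟨a, ha, fun y hy => ⟨s, hs, ha' y hy⟩⟩

/-- Separation of a filter from an ideal by an ultrafilter. -/
theorem exists_of_disjoint (F I : Set A) (hF1 : ⊤ ∈ F) (hFi : ∀ a ∈ F, ∀ b ∈ F, a ⊓ b ∈ F)
    (hFl : ∀ a b, a ≤ b → a ∈ F → b ∈ F) (hI0 : ⊥ ∈ I) (hIs : ∀ a ∈ I, ∀ b ∈ I, a ⊔ b ∈ I)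
    (hIl : ∀ a b, a ≤ b → b ∈ I → a ∈ I) (hd : ∀ a ∈ F, a ∉ I) :
    ∃ x : BAUltrafilter A, (∀ a ∈ F, a ∈ x.carrier) ∧ ∀ a ∈ I, a ∉ x.carrier := by
  have hF' : Order.IsPFilter F := Order.IsPFilter.of_def ⟨⊤, hF1⟩
    (fun a ha b hb => ⟨a ⊓ b, hFi a ha b hb, inf_le_left, inf_le_right⟩)
    (fun {a b} h ha => hFl a b h ha)
  have hI' : Order.IsIdeal I := ⟨fun a b h ha => hIl b a h ha, ⟨⊥, hI0⟩,
    fun a ha b hb => ⟨a ⊔ b, hIs a ha b hb, le_sup_left, le_sup_right⟩⟩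
  obtain ⟨J, hJ, hIJ, hFJ⟩ := DistribLattice.prime_ideal_of_disjoint_filter_ideal
    (F := hF'.toPFilter) (I := hI'.toIdeal) (Set.disjoint_left.2 fun a ha h => hd a ha h)
  have hFJ' : ∀ a ∈ F, a ∉ J := fun a ha h =>
    (Set.disjoint_left.1 hFJ : _) ha h
  refine ⟨⟨{a | a ∉ J}, hFJ' ⊤ hF1, fun h => h J.bot_mem, ?_, ?_, ?_⟩, hFJ', fun a ha h => h (hIJ ha)⟩
  · intro a b ha hb h
    exact (hJ.mem_or_mem h).elim ha hb
  · intro a b hab ha hb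
    exact ha (J.lower hab hb)
  · intro a
    by_contra h
    simp only [Set.mem_ofPred_eq, not_or, not_not] at h
    have := Order.Ideal.sup_mem h.1 h.2
    rw [sup_compl_eq_top] at this
    exact hFJ' ⊤ hF1 this

/-- The indicator embedding into a power of the two-point discrete space. -/
noncomputable def toBool (x : BAUltrafilter A) (a : A) : Bool :=
  open Classical in decide (a ∈ x.carrier)

theorem toBool_eq_true (x : BAUltrafilter A) (a : A) : x.toBool a = true ↔ a ∈ x.carrier := by
  simp [toBool]

theorem continuous_toBool : Continuous (toBool (A := A)) := by
  refine continuous_pi fun a => ?_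
  rw [continuous_bool_rng true]
  convert isClopen_mem a using 1
  ext x
  simp [toBool_eq_true]

theorem isInducing_toBool : Topology.IsInducing (toBool (A := A)) := by
  refine ⟨le_antisymm continuous_toBool.le_induced ?_⟩
  refine le_generateFrom ?_
  rintro _ ⟨a, rfl⟩
  refine isOpen_induced_iff.2 ⟨{g | g a = true}, ?_, ?_⟩
  · exact (isOpen_discrete ({true} : Set Bool)).preimage
      (continuous_apply (A := fun _ : A => Bool) a)
  · ext x; simp [toBool_eq_true]

theorem range_toBool : Set.range (toBool (A := A)) =
    {g | g ⊤ = true} ∩ {g | g ⊥ = false} ∩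
    (⋂ (a : A) (b : A), {g | g (a ⊓ b) = (g a && g b)}) ∩
    (⋂ a : A, {g | g aᶜ = !g a}) := by
  ext g
  simp only [Set.mem_range, Set.mem_inter_iff, Set.mem_iInter, Set.mem_ofPred_eq]
  constructor
  · rintro ⟨x, rfl⟩
    refine ⟨⟨⟨?_, ?_⟩, fun a b => ?_⟩, fun a => ?_⟩
    · simp [toBool, x.top_mem]
    · simp [toBool, x.bot_notMem]
    · rw [Bool.eq_iff_iff]; simp [toBool, x.inf_mem_iff]
    · rw [Bool.eq_iff_iff]; simp [toBool, x.compl_mem_iff]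
  · rintro ⟨⟨⟨h1, h2⟩, h3⟩, h4⟩
    refine ⟨⟨{a | g a = true}, h1, by simp [h2], fun a b ha hb => ?_, fun a b hab ha => ?_,
      fun a => ?_⟩, ?_⟩
    · simp only [Set.mem_ofPred_eq] at ha hb ⊢
      rw [h3, ha, hb]; rfl
    · simp only [Set.mem_ofPred_eq] at ha ⊢
      have := h3 a b
      rw [inf_eq_left.2 hab, ha] at this
      simpa using this.symm
    · simp only [Set.mem_ofPred_eq]
      rw [h4]; cases g a <;> simp
    · funext a
      simp [toBool]

instance : CompactSpace (BAUltrafilter A) := by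
  refine ⟨isInducing_toBool.isCompact_iff.2 ?_⟩
  rw [Set.image_univ]
  refine IsClosed.isCompact ?_
  rw [range_toBool]
  refine ((IsClosed.inter ?_ ?_).inter ?_).inter ?_
  · exact isClosed_eq (continuous_apply _) continuous_const
  · exact isClosed_eq (continuous_apply _) continuous_const
  · refine isClosed_iInter fun a => isClosed_iInter fun b =>
      isClosed_eq (continuous_apply _) ?_
    exact (continuous_of_discreteTopology (f := fun p : Bool × Bool => (p.1 && p.2))).comp
      ((continuous_apply (A := fun _ : A => Bool) a).prodMk
        (continuous_apply (A := fun _ : A => Bool) b))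
  · refine isClosed_iInter fun a => isClosed_eq (continuous_apply _) ?_
    exact (continuous_of_discreteTopology (f := fun p : Bool => !p)).comp (continuous_apply a)

instance : TotallySeparatedSpace (BAUltrafilter A) :=
  totallySeparatedSpace_iff_exists_isClopen.2 fun x y hxy => by
    obtain ⟨a, ha⟩ : ∃ a, ¬ (a ∈ x.carrier ↔ a ∈ y.carrier) := by
      by_contra h; push Not at h; exact hxy (ext' h)
    by_cases hax : a ∈ x.carrier
    · exact ⟨_, isClopen_mem a, hax, fun h => ha ⟨fun _ => h, fun _ => hax⟩⟩
    · refine ⟨_, isClopen_mem aᶜ, (x.compl_mem_iff a).2 hax, fun h => ?_⟩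
      exact ha ⟨fun h' => absurd h' hax, fun h' => absurd h' ((y.compl_mem_iff a).1 h)⟩

/-- The inverse image of an ultrafilter under a boolean homomorphism. -/
def comap {B : Type*} [BooleanAlgebra B] (h : BoundedLatticeHom A B) (x : BAUltrafilter B) :
    BAUltrafilter A where
  carrier := h ⁻¹' x.carrier
  top_mem := by simpa using x.top_mem
  bot_notMem := by simpa using x.bot_notMem
  inf_mem a b ha hb := by simpa using x.inf_mem _ _ ha hb
  mem_of_le a b hab ha := x.mem_of_le _ _ (OrderHomClass.mono h hab) ha
  mem_or_compl_mem a := by simpa [map_compl'] using x.mem_or_compl_mem (h a)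

theorem continuous_comap {B : Type*} [BooleanAlgebra B] (h : BoundedLatticeHom A B) :
    Continuous (comap h) := by
  refine continuous_generateFrom_iff.2 ?_
  rintro _ ⟨a, rfl⟩
  exact isOpen_mem (h a)

end BAUltrafilter

/-- `□ : A → A` preserves finite meets. -/
structure IsBAModalOp {A : Type*} [BooleanAlgebra A] (box : A → A) : Prop where
  map_top : box ⊤ = ⊤
  map_inf : ∀ a b : A, box (a ⊓ b) = box a ⊓ box b

/-- `x R y` iff `□⁻¹ x ⊆ y`. -/
def ultraRel {A : Type*} [BooleanAlgebra A] (box : A → A) (x y : BAUltrafilter A) : Prop :=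
  ∀ a : A, box a ∈ x.carrier → a ∈ y.carrier

section UltraRel

variable {A : Type*} [BooleanAlgebra A] {box : A → A}

theorem IsBAModalOp.mono (hb : IsBAModalOp box) {a b : A} (h : a ≤ b) : box a ≤ box b := by
  rw [← inf_eq_left.2 h, hb.map_inf]; exact inf_le_right

/-- Separation of `□⁻¹ x` from an ideal. -/
theorem IsBAModalOp.exists_rel (hb : IsBAModalOp box) (x : BAUltrafilter A) (I : Set A)
    (hI0 : ⊥ ∈ I) (hIs : ∀ a ∈ I, ∀ b ∈ I, a ⊔ b ∈ I)
    (hIl : ∀ a b, a ≤ b → b ∈ I → a ∈ I) (hd : ∀ a ∈ I, box a ∉ x.carrier) :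
    ∃ y, ultraRel box x y ∧ ∀ a ∈ I, a ∉ y.carrier := by
  obtain ⟨y, h1, h2⟩ := BAUltrafilter.exists_of_disjoint {a | box a ∈ x.carrier} I
    (by simpa [hb.map_top] using x.top_mem)
    (fun a ha b hb' => by
      simp only [Set.mem_ofPred_eq] at *
      rw [hb.map_inf]; exact x.inf_mem _ _ ha hb')
    (fun a b hab ha => x.mem_of_le _ _ (hb.mono hab) ha) hI0 hIs hIl
    (fun a ha h => hd a h ha)
  exact ⟨y, h1, h2⟩

theorem isContRel_ultraRel (hb : IsBAModalOp box) : IsContRel (ultraRel box) := by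
  have hR : IsClosed {p : BAUltrafilter A × BAUltrafilter A | ultraRel box p.1 p.2} := by
    have : {p : BAUltrafilter A × BAUltrafilter A | ultraRel box p.1 p.2} =
        ⋂ a, ({p | box a ∈ p.1.carrier}ᶜ ∪ {p | a ∈ p.2.carrier}) := by
      ext p; simp [ultraRel, imp_iff_not_or]
    rw [this]
    exact isClosed_iInter fun a =>
      ((BAUltrafilter.isClopen_mem (box a)).compl.isClosed.preimage continuous_fst).union
      ((BAUltrafilter.isClopen_mem a).isClosed.preimage continuous_snd)
  refine ⟨fun x => ?_, fun F hF => isClosed_relPre hR hF, fun U hU => ?_⟩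
  · exact hR.preimage (Continuous.prodMk_right x)
  · rw [isOpen_iff_forall_mem_open]
    rintro x ⟨y, hyU, hxy⟩
    obtain ⟨a, hay, haU⟩ := BAUltrafilter.exists_basic hU hyU
    refine ⟨{z | box aᶜ ∈ z.carrier}ᶜ, ?_, (BAUltrafilter.isClopen_mem _).compl.isOpen, ?_⟩
    · intro z hz
      obtain ⟨w, hzw, hw⟩ := hb.exists_rel z {b | b ≤ aᶜ} bot_le (fun _ h _ h' => sup_le h h')
        (fun _ _ h h' => h.trans h') (fun b hba h => hz (z.mem_of_le _ _ (hb.mono hba) h))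
      exact ⟨w, haU w (by simpa using (w.compl_mem_iff aᶜ).2 (hw aᶜ le_rfl)), hzw⟩
    · exact fun h => (y.compl_mem_iff a).1 (hxy _ h) hay

theorem isBddMorphism_comap {B : Type*} [BooleanAlgebra B] {box' : B → B}
    (hb' : IsBAModalOp box') (h : BoundedLatticeHom A B)
    (hbox : ∀ a, h (box a) = box' (h a)) :
    IsBddMorphism (ultraRel box') (ultraRel box) (BAUltrafilter.comap h) := by
  intro x
  apply subset_antisymm
  · rintro _ ⟨y, hxy, rfl⟩ a ha
    exact hxy (h a) (by rw [← hbox]; exact ha)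
  · intro z hz
    obtain ⟨y, hxy, hy⟩ := hb'.exists_rel x {b | ∃ a, a ∉ z.carrier ∧ b ≤ h a}
      ⟨⊥, z.bot_notMem, bot_le⟩
      (by
        rintro b ⟨a, ha, hba⟩ b' ⟨a', ha', hba'⟩
        refine ⟨a ⊔ a', ?_, by rw [map_sup]; exact sup_le_sup hba hba'⟩
        rw [← z.compl_mem_iff] at ha ha' ⊢
        rw [compl_sup]; exact z.inf_mem _ _ ha ha')
      (by
        rintro b b' hbb' ⟨a, ha, hba⟩
        exact ⟨a, ha, hbb'.trans hba⟩)
      (by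
        rintro b ⟨a, ha, hba⟩ hbx
        refine ha (hz a ?_)
        change h (box a) ∈ x.carrier
        rw [hbox]
        exact x.mem_of_le _ _ (hb'.mono hba) hbx)
    refine ⟨y, hxy, BAUltrafilter.ext' fun a => ⟨fun hay => ?_, fun haz => ?_⟩⟩
    · by_contra haz
      exact hy (h a) ⟨a, haz, le_rfl⟩ hay
    · have h1 := hy (h aᶜ) ⟨aᶜ, fun h' => (z.compl_mem_iff a).1 h' haz, le_rfl⟩
      rw [map_compl'] at h1
      have h2 := (y.compl_mem_iff (h a)ᶜ).2 h1
      rw [compl_compl] at h2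
      exact h2

end UltraRel

/-! ### The operator on clopen sets -/

section ClopenBox

variable {X : Type*} [TopologicalSpace X] {R : X → X → Prop} (hR : IsContRel R)

/-- `□_R U = X \ R⁻¹[X \ U]` on clopen sets. -/
def clopenBox (U : TopologicalSpace.Clopens X) : TopologicalSpace.Clopens X :=
  ⟨(relPre R (U : Set X)ᶜ)ᶜ, IsClopen.compl
    ⟨hR.isClosed_preimage _ U.isClopen.compl.isClosed,
      hR.isOpen_preimage _ U.isClopen.compl.isOpen⟩⟩

theorem mem_clopenBox (U : TopologicalSpace.Clopens X) (x : X) :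
    x ∈ clopenBox hR U ↔ ∀ y, R x y → y ∈ U := by
  change x ∈ (relPre R (U : Set X)ᶜ)ᶜ ↔ _
  simp only [relPre, Set.mem_compl_iff, Set.mem_ofPred_eq, not_exists, not_and, SetLike.mem_coe]
  exact forall_congr' fun y => ⟨fun h hxy => by_contra fun hn => h hn hxy, fun h hn hxy => hn (h hxy)⟩

theorem isBAModalOp_clopenBox : IsBAModalOp (clopenBox hR) where
  map_top := by
    ext x
    exact ⟨fun _ => trivial, fun _ => (mem_clopenBox hR _ x).2 fun _ _ => trivial⟩
  map_inf U V := by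
    ext x
    change x ∈ clopenBox hR _ ↔ x ∈ clopenBox hR U ∧ x ∈ clopenBox hR V
    simp only [mem_clopenBox]
    exact ⟨fun h => ⟨fun y hy => (h y hy).1, fun y hy => (h y hy).2⟩,
      fun h y hy => ⟨h.1 y hy, h.2 y hy⟩⟩

/-- The inverse image map on clopen sets. -/
def clopenMap {Y : Type*} [TopologicalSpace Y] (φ : C(X, Y)) :
    BoundedLatticeHom (TopologicalSpace.Clopens Y) (TopologicalSpace.Clopens X) where
  toFun U := ⟨φ ⁻¹' U, U.isClopen.preimage φ.continuous⟩
  map_sup' _ _ := rfl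
  map_inf' _ _ := rfl
  map_top' := rfl
  map_bot' := rfl

end ClopenBox

/-! ### The categories -/

/-- Modal bounded archimedean `ℓ`-algebras. -/
structure MBal : Type (u + 1) where
  carrier : Type u
  [commRing : CommRing carrier]
  [lattice : Lattice carrier]
  [algebra : Algebra ℝ carrier]
  [isBal : IsBal carrier]
  box : carrier → carrier
  isModalOp : IsModalOp box

attribute [instance] MBal.commRing MBal.lattice MBal.algebra MBal.isBal

/-- Unital `ℓ`-algebra homomorphisms preserving `□`. -/
@[ext]
structure MBal.Hom (A B : MBal.{u}) where
  toAlgHom : A.carrier →ₐ[ℝ] B.carrier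
  map_sup : ∀ a b, toAlgHom (a ⊔ b) = toAlgHom a ⊔ toAlgHom b
  map_inf : ∀ a b, toAlgHom (a ⊓ b) = toAlgHom a ⊓ toAlgHom b
  map_box : ∀ a, toAlgHom (A.box a) = B.box (toAlgHom a)

instance : Category.{u} MBal.{u} where
  Hom := MBal.Hom
  id A := ⟨AlgHom.id ℝ A.carrier, fun _ _ => rfl, fun _ _ => rfl, fun _ => rfl⟩
  comp f g := ⟨g.toAlgHom.comp f.toAlgHom,
    fun a b => by simp [f.map_sup, g.map_sup], fun a b => by simp [f.map_inf, g.map_inf],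
    fun a => by simp [f.map_box, g.map_box]⟩

theorem MBal.Hom.map_abs {A B : MBal.{u}} (f : MBal.Hom A B) (a : A.carrier) :
    f.toAlgHom |a| = |f.toAlgHom a| := by
  rw [abs, abs, f.map_sup, map_neg]

/-- Uniformly complete and clean objects. -/
def isCleanUnifComplete : ObjectProperty MBal.{u} := fun A =>
  IsUnifComplete A.carrier ∧ IsCleanRing A.carrier

/-- The category of clean uniformly complete modal bounded archimedean `ℓ`-algebras, a full
subcategory of `MBal`. -/
abbrev MCubal : Type (u + 1) := isCleanUnifComplete.{u}.FullSubcategory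

/-- Compact Hausdorff frames. -/
structure KHFrame : Type (u + 1) where
  carrier : Type u
  [topology : TopologicalSpace carrier]
  [compact : CompactSpace carrier]
  [t2 : T2Space carrier]
  rel : carrier → carrier → Prop
  isContRel : IsContRel rel

attribute [instance] KHFrame.topology KHFrame.compact KHFrame.t2

/-- Continuous bounded morphisms. -/
@[ext]
structure KHFrame.Hom (X Y : KHFrame.{u}) where
  toMap : C(X.carrier, Y.carrier)
  isBdd : IsBddMorphism X.rel Y.rel toMap

instance : Category.{u} KHFrame.{u} where
  Hom := KHFrame.Hom
  id X := ⟨ContinuousMap.id _, fun x => by simp⟩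
  comp f g := ⟨g.toMap.comp f.toMap, fun x => by
    have h1 := f.isBdd x
    have h2 := g.isBdd (f.toMap x)
    rw [← h1, Set.image_image] at h2
    exact h2⟩

/-- The underlying space is a Stone space. -/
def isStoneFrame : ObjectProperty KHFrame.{u} := fun X => TotallyDisconnectedSpace X.carrier

/-- The category of descriptive frames, a full subcategory of `KHFrame`. -/
abbrev DescFrame : Type (u + 1) := isStoneFrame.{u}.FullSubcategory

/-- Modal algebras. -/
structure ModalAlg : Type (u + 1) where
  carrier : Type u
  [booleanAlgebra : BooleanAlgebra carrier]
  box : carrier → carrier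
  isBAModalOp : IsBAModalOp box

attribute [instance] ModalAlg.booleanAlgebra

/-- Boolean homomorphisms preserving `□`. -/
@[ext]
structure ModalAlg.Hom (A B : ModalAlg.{u}) where
  toHom : BoundedLatticeHom A.carrier B.carrier
  map_box : ∀ a, toHom (A.box a) = B.box (toHom a)

instance : Category.{u} ModalAlg.{u} where
  Hom := ModalAlg.Hom
  id A := ⟨BoundedLatticeHom.id _, fun _ => rfl⟩
  comp f g := ⟨g.toHom.comp f.toHom, fun a => by simp [f.map_box, g.map_box]⟩

/-! ### The functors -/

/-- The restriction of an algebra homomorphism to the idempotents. -/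
def idemMap {A B : Type*} [CommRing A] [CommRing B] [Algebra ℝ A] [Algebra ℝ B]
    (f : A →ₐ[ℝ] B) : BoundedLatticeHom (Idem A) (Idem B) where
  toFun e := ⟨f e.1, e.2.map f⟩
  map_sup' e e' := Subtype.ext (by
    change f (e ⊔ e').1 = f e.1 + f e'.1 - f e.1 * f e'.1
    rw [idem_sup, map_sub, map_add, map_mul])
  map_inf' e e' := Subtype.ext (by
    change f (e ⊓ e').1 = f e.1 * f e'.1
    rw [idem_inf, map_mul])
  map_top' := Subtype.ext (by simp [idem_top])
  map_bot' := Subtype.ext (by simp [idem_bot])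

/-- The restriction of `□` to the idempotents. -/
def idemBox (A : MBal.{u}) (e : Idem A.carrier) : Idem A.carrier :=
  ⟨A.box e.1, A.isModalOp.isIdempotentElem e.2⟩

theorem isBAModalOp_idemBox (A : MBal.{u}) : IsBAModalOp (idemBox A) where
  map_top := Subtype.ext A.isModalOp.box_one
  map_inf e f := Subtype.ext (by
    rw [idem_inf]
    change A.box (e ⊓ f).1 = A.box e.1 * A.box f.1
    rw [idem_inf, mul_eq_inf e.2 f.2, A.isModalOp.map_inf,
      mul_eq_inf (A.isModalOp.isIdempotentElem e.2) (A.isModalOp.isIdempotentElem f.2)])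

/-- The functor `Id` on modal bounded archimedean `ℓ`-algebras. -/
def idFunctorMBal : MBal.{u} ⥤ ModalAlg.{u} where
  obj A := { carrier := Idem A.carrier, box := idemBox A, isBAModalOp := isBAModalOp_idemBox A }
  map f := ⟨idemMap f.toAlgHom, fun e => Subtype.ext (f.map_box e.1)⟩

/-- The functor `Id` on clean uniformly complete objects. -/
def idFunctor : MCubal.{u} ⥤ ModalAlg.{u} := isCleanUnifComplete.ι ⋙ idFunctorMBal

/-- The contravariant functor `(-)_*` sending `(A, □)` to its Yosida space with the dual
relation. -/
def yosidaFunctorMBal : MBal.{u}ᵒᵖ ⥤ KHFrame.{u} where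
  obj A :=
    { carrier := Yosida A.unop.carrier
      rel := yosidaRel A.unop.box
      isContRel := isContRel_yosidaRel A.unop.isModalOp }
  map {A B} f := ⟨⟨yosidaMap f.unop.toAlgHom f.unop.map_abs,
      continuous_yosidaMap f.unop.toAlgHom f.unop.map_abs⟩,
    isBddMorphism_yosidaMap B.unop.isModalOp A.unop.isModalOp f.unop.toAlgHom f.unop.map_abs
      f.unop.map_box⟩

/-- `(-)_*` restricted to clean uniformly complete objects. -/
def yosidaFunctor : MCubal.{u}ᵒᵖ ⥤ DescFrame.{u} :=
  isStoneFrame.lift (isCleanUnifComplete.ι.op ⋙ yosidaFunctorMBal)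
    fun A => totallyDisconnected_yosida A.unop.property.2

/-- The contravariant functor `(-)^*` sending `(X, R)` to `(C(X), □_R)`. -/
noncomputable def contFunctorKHFrame : KHFrame.{u}ᵒᵖ ⥤ MBal.{u} where
  obj X :=
    { carrier := C(X.unop.carrier, ℝ)
      box := boxC X.unop.isContRel
      isModalOp := isModalOp_boxC X.unop.isContRel }
  map {X Y} φ :=
    { toAlgHom := ContinuousMap.compRightAlgHom ℝ ℝ φ.unop.toMap
      map_sup := fun _ _ => rfl
      map_inf := fun _ _ => rfl
      map_box := fun f => by
        ext x
        exact (boxFun_comp φ.unop.isBdd f x).symm }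

/-- `(-)^*` restricted to descriptive frames. -/
noncomputable def contFunctor : DescFrame.{u}ᵒᵖ ⥤ MCubal.{u} :=
  isCleanUnifComplete.lift (isStoneFrame.ι.op ⋙ contFunctorKHFrame) fun X =>
    ⟨isUnifComplete_continuousMap _,
      haveI : TotallyDisconnectedSpace X.unop.obj.carrier := X.unop.property
      isCleanRing_continuousMap X.unop.obj.carrier⟩

/-- The contravariant functor `(-)_*` sending a modal algebra to its space of ultrafilters with
the dual relation. -/
def ultraFunctor : ModalAlg.{u}ᵒᵖ ⥤ DescFrame.{u} where
  obj A :=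
    { obj :=
        { carrier := BAUltrafilter A.unop.carrier
          rel := ultraRel A.unop.box
          isContRel := isContRel_ultraRel A.unop.isBAModalOp }
      property := inferInstanceAs (TotallyDisconnectedSpace (BAUltrafilter A.unop.carrier)) }
  map {A B} f := ObjectProperty.homMk
    (⟨⟨BAUltrafilter.comap f.unop.toHom, BAUltrafilter.continuous_comap f.unop.toHom⟩,
      isBddMorphism_comap A.unop.isBAModalOp f.unop.toHom f.unop.map_box⟩ : KHFrame.Hom _ _)

/-- The contravariant functor `(-)^*` sending a descriptive frame to its boolean algebra of clopen
sets with `□_R`. -/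
def clopenFunctor : DescFrame.{u}ᵒᵖ ⥤ ModalAlg.{u} where
  obj X :=
    { carrier := TopologicalSpace.Clopens X.unop.obj.carrier
      box := clopenBox X.unop.obj.isContRel
      isBAModalOp := isBAModalOp_clopenBox X.unop.obj.isContRel }
  map {X Y} φ := ⟨clopenMap φ.unop.hom.toMap, fun U => by
    ext x
    change φ.unop.hom.toMap x ∈ clopenBox X.unop.obj.isContRel U ↔
      x ∈ clopenBox Y.unop.obj.isContRel (clopenMap φ.unop.hom.toMap U)
    rw [mem_clopenBox, mem_clopenBox]
    have h := φ.unop.hom.isBdd x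
    constructor
    · intro h1 y hy
      exact h1 _ (h.subset ⟨y, hy, rfl⟩)
    · intro h1 z hz
      obtain ⟨y, hy, rfl⟩ := h.superset hz
      exact h1 y hy⟩

end ModalDuality

open ModalDuality CategoryTheory

namespace ModalDuality

/-! ### Isomorphisms from bijective morphisms -/

/-! The two dualities are Gelfand duality and Stone duality, each enriched by a relation on the dual
space; the statements about `Id` then follow by composing natural isomorphisms.

On the algebra side, an element `a` is sent to the function `x ↦ ev x a` on the Yosida space. This
is injective because maximal `ℓ`-ideals detect the order, and isometric because the bound `|a| ≤ r`
can be tested pointwise (`unifNorm_eq_norm_gelfand`). Its image is a point-separating subalgebra,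
hence dense by Stone–Weierstrass, and uniform completeness makes it everything
(`gelfand_surjective`). The modal operator is matched in `gelfand_box`: when `□ 0` vanishes at `x`,
the value of `□ a` at `x` is the minimum of `a` on `R[x]`, which is attained by
`IsModalOp.exists_attains`. Conversely, every maximal `ℓ`-ideal of `C(X)` is evaluation at a point
(`yosidaPoint_surjective`), and the relation can be read off from `□_R` by Urysohn functions, since
each `R[x]` is closed (`yosidaRel_yosidaPoint`).

On the boolean side the pattern is the same. The prime ideal theorem replaces the separation of
elements by maximal `ℓ`-ideals (`stone_injective`, `stone_box`), compactness makes every clopen set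
of ultrafilters basic (`stone_surjective`), and clopen separation replaces Urysohn's lemma
(`ultraRel_clopenPoint`).

The bridge is that idempotents of `C(X)` are indicators of clopen sets, and the minimum of such a
function over `R[x]` is `1` exactly when `R[x]` lies in the clopen set (`idemClopen_box`). So `Id ∘
C ≅ Clop`. Since `A ≅ C(Y_A)`, this gives `Id ≅ Clop ∘ Y`, then `Ult ∘ Id ≅ Ult ∘ Clop ∘ Y ≅ Y`. A
quasi-inverse of `Id` is therefore `C ∘ Ult`: one composite is `C ∘ Ult ∘ Id ≅ C ∘ Y ≅ 1`, the other
`Id ∘ C ∘ Ult ≅ Clop ∘ Ult ≅ 1`. Uniform completeness enters only through surjectivity of `gelfand`,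
and cleanness only through total disconnectedness of the Yosida space. -/

/-- A bijective morphism of modal bounded archimedean `ℓ`-algebras is an isomorphism. -/
noncomputable def MBal.isoOfBijective {A B : MBal.{u}} (f : MBal.Hom A B)
    (hf : Function.Bijective f.toAlgHom) : A ≅ B where
  hom := f
  inv :=
    { toAlgHom := (AlgEquiv.ofBijective f.toAlgHom hf).symm
      -- Each identity for the inverse is checked after applying the injective map `f`, where it
      -- becomes the corresponding property of `f`.
      map_sup := fun a b => hf.1 <| by
        have h := (AlgEquiv.ofBijective f.toAlgHom hf).apply_symm_apply
        simp only [AlgEquiv.ofBijective_apply] at h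
        simp [f.map_sup, h]
      map_inf := fun a b => hf.1 <| by
        have h := (AlgEquiv.ofBijective f.toAlgHom hf).apply_symm_apply
        simp only [AlgEquiv.ofBijective_apply] at h
        simp [f.map_inf, h]
      map_box := fun a => hf.1 <| by
        have h := (AlgEquiv.ofBijective f.toAlgHom hf).apply_symm_apply
        simp only [AlgEquiv.ofBijective_apply] at h
        simp [f.map_box, h] }
  hom_inv_id := MBal.Hom.ext <| AlgHom.ext fun a =>
    (AlgEquiv.ofBijective f.toAlgHom hf).symm_apply_apply a
  inv_hom_id := MBal.Hom.ext <| AlgHom.ext fun b =>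
    (AlgEquiv.ofBijective f.toAlgHom hf).apply_symm_apply b

/-- A bijective morphism of modal algebras is an isomorphism. -/
noncomputable def ModalAlg.isoOfBijective {A B : ModalAlg.{u}} (f : ModalAlg.Hom A B)
    (hf : Function.Bijective f.toHom) : A ≅ B :=
  have h (b : B.carrier) : f.toHom ((Equiv.ofBijective f.toHom hf).symm b) = b :=
    (Equiv.ofBijective f.toHom hf).apply_symm_apply b
  { hom := f
    inv :=
      { toHom :=
          { toFun := (Equiv.ofBijective f.toHom hf).symm
            map_sup' := fun a b => hf.1 <| by rw [map_sup f.toHom, h, h, h]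
            map_inf' := fun a b => hf.1 <| by rw [map_inf f.toHom, h, h, h]
            map_top' := hf.1 <| by rw [h, map_top]
            map_bot' := hf.1 <| by rw [h, map_bot] }
        map_box := fun a => hf.1 <| by
          rw [f.map_box]
          exact (h _).trans (congrArg B.box (h a).symm) }
    hom_inv_id := ModalAlg.Hom.ext <| DFunLike.ext _ _ fun a =>
      (Equiv.ofBijective f.toHom hf).symm_apply_apply a
    inv_hom_id := ModalAlg.Hom.ext <| DFunLike.ext _ _ h }

/-- A relation-preserving and -reflecting bijection is a bounded morphism. -/
theorem isBddMorphism_of_surjective {X Y : Type*} {R : X → X → Prop} {S : Y → Y → Prop}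
    {f : X → Y} (hf : Function.Surjective f) (h : ∀ x y, R x y ↔ S (f x) (f y)) :
    IsBddMorphism R S f := by
  intro x
  ext z
  constructor
  · rintro ⟨y, hy, rfl⟩
    exact (h x y).1 hy
  · intro hz
    obtain ⟨y, rfl⟩ := hf z
    exact ⟨y, (h x y).2 hz, rfl⟩

/-- A continuous bijection of compact Hausdorff frames that preserves and reflects the relation is
an isomorphism. -/
noncomputable def KHFrame.isoOfBijective {X Y : KHFrame.{u}} (f : C(X.carrier, Y.carrier))
    (hf : Function.Bijective f) (h : ∀ x y, X.rel x y ↔ Y.rel (f x) (f y)) : X ≅ Y :=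
  let e := Continuous.homeoOfEquivCompactToT2 (f := Equiv.ofBijective f hf) f.continuous
  { hom := (⟨f, isBddMorphism_of_surjective hf.2 h⟩ : KHFrame.Hom X Y)
    inv := (⟨⟨e.symm, e.symm.continuous⟩, isBddMorphism_of_surjective e.symm.surjective fun x y => by
      have he (z : Y.carrier) : f (e.symm z) = z := e.apply_symm_apply z
      change Y.rel x y ↔ X.rel (e.symm x) (e.symm y)
      rw [h, he, he]⟩ : KHFrame.Hom Y X)
    hom_inv_id := KHFrame.Hom.ext <| ContinuousMap.ext e.symm_apply_apply
    inv_hom_id := KHFrame.Hom.ext <| ContinuousMap.ext e.apply_symm_apply }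

/-! ### The algebra of continuous functions on the Yosida space -/

section Gelfand

variable {A : Type*} [CommRing A] [Lattice A] [Algebra ℝ A] [hA : IsBal A]

/-- The map sending `a` to the function `x ↦ ev x a`. -/
noncomputable def gelfand (A : Type*) [CommRing A] [Lattice A] [Algebra ℝ A] [IsBal A] :
    A →ₐ[ℝ] C(Yosida A, ℝ) where
  toFun a := ⟨fun x => ev x a, continuous_ev a⟩
  map_one' := by ext x; exact map_one (ev x)
  map_zero' := by ext x; exact map_zero (ev x)
  map_add' a b := by ext x; exact map_add (ev x) a b
  map_mul' a b := by ext x; exact map_mul (ev x) a b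
  commutes' r := by ext x; exact ev_const x r

/-- An element vanishing at every maximal `ℓ`-ideal is zero; behind `eq_of_ev` this is where the
archimedean axiom is used. -/
theorem gelfand_injective : Function.Injective (gelfand A) := fun _ _ h =>
  eq_of_ev fun x => DFunLike.congr_fun h x

/-- Both norms are infima of sets of real bounds, and the two sets coincide: evaluations are
monotone and jointly reflect the order. Cauchy sequences and limits can thus be moved between `A`
and `C(Yosida A)`. -/
theorem unifNorm_eq_norm_gelfand (a : A) : unifNorm a = ‖gelfand A a‖ := by
  rw [← unifNorm_continuousMap, unifNorm, unifNorm]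
  congr 1
  ext r
  constructor
  · intro h x
    have := ev_mono x h
    rwa [ev_abs, ev_const] at this
  · intro h
    refine le_of_ev fun x => ?_
    rw [ev_abs, ev_const]
    exact h x

/-- Stone–Weierstrass on the compact Yosida space makes the image dense, and an isometric image of a
complete algebra is closed. -/
theorem gelfand_surjective (hc : IsUnifComplete A) : Function.Surjective (gelfand A) := by
  -- Two maximal `ℓ`-ideals at which all elements take the same values are equal.
  have hsep : (gelfand A).range.SeparatesPoints := by
    intro x y hxy
    by_contra! h
    exact hxy (ext_ev fun a => h _ ⟨_, ⟨a, rfl⟩, rfl⟩)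
  intro f
  have hf : f ∈ closure (Set.range (gelfand A)) := by
    have h := ContinuousMap.subalgebra_topologicalClosure_eq_top_of_separatesPoints _ hsep
    have h' : f ∈ (gelfand A).range.topologicalClosure := h ▸ Algebra.mem_top
    exact h'
  obtain ⟨s, hs, hlim⟩ := mem_closure_iff_seq_limit.1 hf
  choose t ht using hs
  -- The approximants of `f` form a Cauchy sequence in `C(Yosida A)`, so by the isometry their
  -- preimages `t n` are Cauchy for `unifNorm` and have a limit `a` in `A`.
  obtain ⟨a, ha⟩ := hc t fun ε hε => by
    obtain ⟨N, hN⟩ := Metric.cauchySeq_iff.1 hlim.cauchySeq ε hε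
    refine ⟨N, fun m hm n hn => ?_⟩
    rw [unifNorm_eq_norm_gelfand, map_sub, ht, ht, ← dist_eq_norm]
    exact hN m hm n hn
  -- The same approximants converge to both `gelfand A a` and `f`.
  refine ⟨a, tendsto_nhds_unique (Metric.tendsto_atTop.2 fun ε hε => ?_) hlim⟩
  obtain ⟨N, hN⟩ := ha ε hε
  refine ⟨N, fun n hn => ?_⟩
  rw [← ht, dist_eq_norm, ← map_sub, ← unifNorm_eq_norm_gelfand]
  exact hN n hn

/-- `box 0` is idempotent, so its value at `x` is `0` or `1`; these are the cases where `R[x]` is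
nonempty and empty. In the first, every successor of `x` bounds `box a` from above by its value of
`a`, and some successor attains the bound. -/
theorem gelfand_box {box : A → A} (hb : IsModalOp box) (a : A) :
    gelfand A (box a) = boxC (isContRel_yosidaRel hb) (gelfand A a) := by
  ext x
  change ev x (box a) = boxFun (yosidaRel box) (gelfand A a) x
  rcases hb.ev_zero x with hx | hx
  · obtain ⟨y, hxy, hy⟩ := hb.exists_attains hx a
    rw [boxFun_eq (isContRel_yosidaRel hb) (gelfand A a).continuous hxy fun z hz =>
      hy.trans (((yosidaRel_iff hb x z).1 hz).2 a)]
    exact le_antisymm (((yosidaRel_iff hb x y).1 hxy).2 a) hy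
  -- If `box 0` is `1` at `x`, then so is every `box a`, which agrees with the default value `1` of
  -- `boxFun`; and `x` has no successor, since one would force `box 0` to vanish at `x`.
  · rw [hb.ev_box_of_one hx, boxFun_of_empty]
    rintro ⟨y, hy⟩
    have := ((yosidaRel_iff hb x y).1 hy).1
    rw [hx] at this
    exact one_ne_zero this

end Gelfand

/-- A clean uniformly complete modal algebra is isomorphic to the algebra of continuous functions
on its Yosida space. -/
noncomputable def gelfandIso (A : MCubal.{u}) :
    A ≅ (yosidaFunctor.{u}.rightOp ⋙ contFunctor.{u}).obj A :=
  isCleanUnifComplete.isoMk <| MBal.isoOfBijective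
    (B := ((yosidaFunctor.{u}.rightOp ⋙ contFunctor.{u}).obj A).obj)
    { toAlgHom := gelfand A.obj.carrier
      map_sup := fun a b => ContinuousMap.ext fun x => ev_sup x a b
      map_inf := fun a b => ContinuousMap.ext fun x => ev_inf x a b
      map_box := fun a => gelfand_box A.obj.isModalOp a }
    ⟨gelfand_injective, gelfand_surjective A.property.1⟩

/-- The composite of `(-)_*` and `(-)^*` is the identity of `MCubal`. -/
noncomputable def yosidaContIso : yosidaFunctor.{u}.rightOp ⋙ contFunctor.{u} ≅ 𝟭 MCubal.{u} :=
  -- The components run from the identity to the composite, hence the final `symm`. Naturality,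
  -- tested at a point, is the formula for evaluation at an inverse-image ideal.
  (NatIso.ofComponents (F := 𝟭 MCubal.{u}) gelfandIso fun {_ _} f =>
    InducedCategory.Hom.ext <| MBal.Hom.ext <| AlgHom.ext fun a => ContinuousMap.ext fun x =>
      (ev_yosidaMap f.hom.toAlgHom f.hom.map_abs x a).symm).symm

/-! ### The Yosida space of an algebra of continuous functions -/

section Point

variable {X : Type*} [TopologicalSpace X] [CompactSpace X]

/-- The maximal `ℓ`-ideal of functions vanishing at a point. -/
def yosidaPoint (x : X) : Yosida C(X, ℝ) :=
  ofHom (ContinuousMap.evalAlgHom ℝ ℝ x) fun _ => rfl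

theorem ev_yosidaPoint (x : X) (f : C(X, ℝ)) : ev (yosidaPoint x) f = f x :=
  ev_ofHom _ _ f

theorem continuous_yosidaPoint : Continuous (yosidaPoint (X := X)) := by
  rw [isInducing_ev.continuous_iff]
  refine continuous_pi fun f => ?_
  simp only [Function.comp_def, ev_yosidaPoint]
  exact f.continuous

/-- Naturality of the point map: both ideals assign to `f` the value `f (φ x)`. -/
theorem yosidaMap_yosidaPoint {Y : Type*} [TopologicalSpace Y] [CompactSpace Y] (φ : C(X, Y))
    (hφ : ∀ f, ContinuousMap.compRightAlgHom ℝ ℝ φ |f| = |ContinuousMap.compRightAlgHom ℝ ℝ φ f|)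
    (x : X) : yosidaPoint (φ x) =
      yosidaMap (ContinuousMap.compRightAlgHom ℝ ℝ φ) hφ (yosidaPoint x) :=
  ext_ev fun f => by
    rw [ev_yosidaMap, ev_yosidaPoint, ev_yosidaPoint]
    rfl

/-- A compact Hausdorff space is normal, so a Urysohn function separates distinct points. -/
theorem yosidaPoint_injective [T2Space X] : Function.Injective (yosidaPoint (X := X)) := by
  intro x y hxy
  by_contra hne
  obtain ⟨f, hfx, hfy, -⟩ := exists_continuous_zero_one_of_isClosed (isClosed_singleton (x := x))
    (isClosed_singleton (x := y)) (Set.disjoint_singleton.2 hne)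
  have h := congrArg (fun z => ev z f) hxy
  simp only [ev_yosidaPoint, hfx (Set.mem_singleton x), hfy (Set.mem_singleton y)] at h
  exact zero_ne_one h

/-- The range is compact, hence closed. A point outside it would have a basic neighbourhood `{ev f <
0}` missing the range; then `f` is nonnegative at every point of `X`, so it cannot be negative at
any maximal `ℓ`-ideal. -/
theorem yosidaPoint_surjective : Function.Surjective (yosidaPoint (X := X)) := by
  intro y
  by_contra hy
  have hcl : IsClosed (Set.range (yosidaPoint (X := X))) :=
    (isCompact_range continuous_yosidaPoint).isClosed
  obtain ⟨f, hfy, hf⟩ := exists_basic hcl.isOpen_compl hy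
  have h0 : 0 ≤ f := fun x => by
    change 0 ≤ f x
    by_contra! hx
    exact hf (yosidaPoint x) (by rwa [ev_yosidaPoint]) ⟨x, rfl⟩
  exact absurd (ev_nonneg y h0) (not_le.2 hfy)

/-- The relation is recovered from `boxC hR` because `R[x]` is closed: a point outside it is
separated from it by a continuous function. -/
theorem yosidaRel_yosidaPoint [T2Space X] {R : X → X → Prop} (hR : IsContRel R) (x y : X) :
    R x y ↔ yosidaRel (boxC hR) (yosidaPoint x) (yosidaPoint y) := by
  rw [yosidaRel_iff (isModalOp_boxC hR)]
  simp only [ev_yosidaPoint]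
  change _ ↔ boxFun R (fun _ => 0) x = 0 ∧ ∀ f : C(X, ℝ), boxFun R f x ≤ f y
  constructor
  · intro hxy
    refine ⟨boxFun_eq hR continuous_const hxy fun _ _ => le_rfl, fun f => ?_⟩
    obtain ⟨z, -, he, hmin⟩ := exists_boxFun hR f.continuous ⟨y, hxy⟩
    rw [he]
    exact hmin y hxy
  · rintro ⟨h0, h⟩
    by_contra hxy
    -- Were `R[x]` empty, the default value would make the box of `0` equal to `1` at `x`.
    have hne : ∃ z, R x z := by
      by_contra hn
      rw [boxFun_of_empty hn] at h0
      exact one_ne_zero h0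
    -- This `f` is `0` at `y` and `1` on `R[x]`, so its box at `x` is `1`, exceeding `f y`.
    obtain ⟨f, hfy, hf, -⟩ := exists_continuous_zero_one_of_isClosed
      (isClosed_singleton (x := y)) (hR.isClosed_image x) (Set.disjoint_singleton_left.2 hxy)
    obtain ⟨z, hz, he, -⟩ := exists_boxFun hR f.continuous hne
    have h1 := h f
    rw [he, hf hz, hfy (Set.mem_singleton y)] at h1
    exact absurd h1 (by norm_num)

end Point

/-- A descriptive frame is isomorphic to the Yosida space of its algebra of continuous
functions. -/
noncomputable def yosidaPointIso (X : DescFrame.{u}) :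
    X ≅ (contFunctor.{u}.rightOp ⋙ yosidaFunctor.{u}).obj X :=
  isStoneFrame.isoMk <| KHFrame.isoOfBijective
    (Y := ((contFunctor.{u}.rightOp ⋙ yosidaFunctor.{u}).obj X).obj)
    ⟨yosidaPoint, continuous_yosidaPoint⟩ ⟨yosidaPoint_injective, yosidaPoint_surjective⟩
    (yosidaRel_yosidaPoint X.obj.isContRel)

/-- The composite of `(-)^*` and `(-)_*` is the identity of `DescFrame`. -/
noncomputable def contYosidaIso :
    contFunctor.{u}.rightOp ⋙ yosidaFunctor.{u} ≅ 𝟭 DescFrame.{u} :=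
  (NatIso.ofComponents (F := 𝟭 DescFrame.{u}) yosidaPointIso fun {_ _} φ =>
    InducedCategory.Hom.ext <| KHFrame.Hom.ext <| ContinuousMap.ext
      (yosidaMap_yosidaPoint φ.hom.toMap fun _ => rfl)).symm

/-! ### The boolean algebra of clopen sets of ultrafilters -/

section Stone

variable {A : Type*} [BooleanAlgebra A]

namespace BAUltrafilter

theorem sup_mem_iff (x : BAUltrafilter A) (a b : A) :
    a ⊔ b ∈ x.carrier ↔ a ∈ x.carrier ∨ b ∈ x.carrier := by
  rw [← not_iff_not, not_or, ← compl_mem_iff, ← compl_mem_iff, ← compl_mem_iff, compl_sup,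
    inf_mem_iff]

/-- If `a ≤ b` fails, the principal filter of `a` and the principal ideal of `b` are disjoint, and
the prime ideal theorem gives an ultrafilter containing `a` but not `b`. -/
theorem le_of_forall {a b : A} (h : ∀ x : BAUltrafilter A, a ∈ x.carrier → b ∈ x.carrier) :
    a ≤ b := by
  by_contra hab
  obtain ⟨x, h1, h2⟩ := exists_of_disjoint {c | a ≤ c} {c | c ≤ b} le_top
    (fun _ h _ h' => le_inf h h') (fun _ _ h h' => h'.trans h) bot_le
    (fun _ h _ h' => sup_le h h') (fun _ _ h h' => h.trans h') (fun c h h' => hab (h.trans h'))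
  exact h2 b le_rfl (h x (h1 a le_rfl))

end BAUltrafilter

/-- The Stone map sending `a` to the clopen set of ultrafilters containing `a`. -/
def stone (A : Type*) [BooleanAlgebra A] :
    BoundedLatticeHom A (TopologicalSpace.Clopens (BAUltrafilter A)) where
  toFun a := ⟨{x | a ∈ x.carrier}, BAUltrafilter.isClopen_mem a⟩
  map_sup' a b := by ext x; exact x.sup_mem_iff a b
  map_inf' a b := by ext x; exact x.inf_mem_iff a b
  map_top' := by ext x; exact iff_of_true x.top_mem trivial
  map_bot' := by ext x; exact iff_of_false x.bot_notMem id

theorem mem_stone (a : A) (x : BAUltrafilter A) : x ∈ stone A a ↔ a ∈ x.carrier := Iff.rfl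

theorem stone_injective : Function.Injective (stone A) := fun a b h => by
  have h' (x : BAUltrafilter A) : a ∈ x.carrier ↔ b ∈ x.carrier := by
    rw [← mem_stone, ← mem_stone, h]
  exact le_antisymm (BAUltrafilter.le_of_forall fun x => (h' x).1)
    (BAUltrafilter.le_of_forall fun x => (h' x).2)

/-- A clopen set is a union of basic ones because it is open, and finitely many suffice because it
is compact; their join in `A` is the required element. -/
theorem stone_surjective : Function.Surjective (stone A) := by
  intro U
  obtain ⟨t, ht⟩ := U.isClopen.isClosed.isCompact.elim_finite_subcover
    -- Only basic sets contained in `U` are used, so that the finite join cannot leave `U`.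
    (fun a : {a : A // stone A a ≤ U} => (stone A a.1 : Set (BAUltrafilter A)))
    (fun a => (stone A a.1).isClopen.isOpen) (fun x hx => by
      obtain ⟨a, ha, haU⟩ := BAUltrafilter.exists_basic U.isClopen.isOpen hx
      exact Set.mem_iUnion.2 ⟨⟨a, haU⟩, ha⟩)
  refine ⟨t.sup Subtype.val, le_antisymm ?_ fun x hx => ?_⟩
  · rw [map_finset_sup]
    exact Finset.sup_le fun a _ => a.2
  · obtain ⟨a, ha, hax⟩ := Set.mem_iUnion₂.1 (ht hx)
    exact x.mem_of_le _ _ (Finset.le_sup (f := Subtype.val) ha) hax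

/-- One direction is the definition of `ultraRel`. For the other, if `box a ∉ x`, then the filter
`□⁻¹ x` is disjoint from the principal ideal of `a`, and separating them yields a successor of `x`
that omits `a`. -/
theorem stone_box {box : A → A} (hb : IsBAModalOp box) (a : A) :
    stone A (box a) = clopenBox (isContRel_ultraRel hb) (stone A a) := by
  ext x
  change x ∈ stone A (box a) ↔ x ∈ clopenBox (isContRel_ultraRel hb) (stone A a)
  rw [mem_clopenBox]
  refine ⟨fun h y hxy => hxy a h, fun h => ?_⟩
  by_contra hx
  obtain ⟨y, hxy, hy⟩ := hb.exists_rel x {b | b ≤ a} bot_le (fun _ h _ h' => sup_le h h')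
    (fun _ _ h h' => h.trans h') (fun b hba h' => hx (x.mem_of_le _ _ (hb.mono hba) h'))
  exact hy a le_rfl (h y hxy)

end Stone

/-- A modal algebra is isomorphic to the algebra of clopen sets of its ultrafilter frame. -/
noncomputable def stoneIso (A : ModalAlg.{u}) :
    A ≅ (ultraFunctor.{u}.rightOp ⋙ clopenFunctor.{u}).obj A :=
  ModalAlg.isoOfBijective (B := (ultraFunctor.{u}.rightOp ⋙ clopenFunctor.{u}).obj A)
    ⟨stone A.carrier, stone_box A.isBAModalOp⟩ ⟨stone_injective, stone_surjective⟩

/-- The composite of `(-)_*` and `(-)^*` is the identity of `ModalAlg`. -/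
noncomputable def ultraClopenIso :
    ultraFunctor.{u}.rightOp ⋙ clopenFunctor.{u} ≅ 𝟭 ModalAlg.{u} :=
  (NatIso.ofComponents (F := 𝟭 ModalAlg.{u}) stoneIso fun {_ _} _ => rfl).symm

/-! ### The ultrafilters of clopen sets -/

section ClopenPoint

variable {X : Type*} [TopologicalSpace X]

/-- The ultrafilter of clopen neighbourhoods of a point. -/
def clopenPoint (x : X) : BAUltrafilter (TopologicalSpace.Clopens X) where
  carrier := {U | x ∈ U}
  top_mem := trivial
  bot_notMem := id
  inf_mem _ _ h h' := ⟨h, h'⟩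
  mem_of_le _ _ h h' := h h'
  mem_or_compl_mem U := Classical.em (x ∈ U)

theorem mem_clopenPoint (x : X) (U : TopologicalSpace.Clopens X) :
    U ∈ (clopenPoint x).carrier ↔ x ∈ U := Iff.rfl

theorem continuous_clopenPoint : Continuous (clopenPoint (X := X)) := by
  refine continuous_generateFrom_iff.2 ?_
  rintro _ ⟨U, rfl⟩
  exact U.isClopen.isOpen

variable [CompactSpace X]

/-- The range is compact, hence closed. An ultrafilter outside it would contain a clopen `U`
belonging to no point ultrafilter, that is, the empty set. -/
theorem clopenPoint_surjective : Function.Surjective (clopenPoint (X := X)) := by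
  intro y
  by_contra hy
  have hcl : IsClosed (Set.range (clopenPoint (X := X))) :=
    (isCompact_range continuous_clopenPoint).isClosed
  obtain ⟨U, hUy, hU⟩ := BAUltrafilter.exists_basic hcl.isOpen_compl hy
  have h0 : U = ⊥ := by
    ext x
    exact iff_of_false (fun hx => hU (clopenPoint x) hx ⟨x, rfl⟩) id
  exact y.bot_notMem (h0 ▸ hUy)

variable [T2Space X] [TotallyDisconnectedSpace X]

theorem clopenPoint_injective : Function.Injective (clopenPoint (X := X)) := by
  intro x y hxy
  by_contra hne
  obtain ⟨U, hU, hxU, hyU⟩ := exists_isClopen_of_totally_separated hne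
  have h : (⟨U, hU⟩ : TopologicalSpace.Clopens X) ∈ (clopenPoint y).carrier := hxy ▸ hxU
  exact hyU h

/-- In a Stone space the closed set `R[x]` is an intersection of clopen sets, so the clopen sets
containing `R[x]` determine it. -/
theorem ultraRel_clopenPoint {R : X → X → Prop} (hR : IsContRel R) (x y : X) :
    R x y ↔ ultraRel (clopenBox hR) (clopenPoint x) (clopenPoint y) := by
  simp only [ultraRel, mem_clopenPoint, mem_clopenBox]
  refine ⟨fun hxy U hU => hU y hxy, fun h => ?_⟩
  by_contra hxy
  obtain ⟨V, hV, hyV, hVR⟩ := compact_exists_isClopen_in_isOpen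
    (hR.isClosed_image x).isOpen_compl hxy
  -- The clopen `V` contains `y` and misses `R[x]`, so `Vᶜ` contains every successor of `x` but not
  -- `y`.
  exact h ⟨Vᶜ, hV.compl⟩ (fun z hz hzV => hVR hzV hz) hyV

end ClopenPoint

/-- A descriptive frame is isomorphic to the ultrafilter frame of its algebra of clopen sets. -/
noncomputable def clopenPointIso (X : DescFrame.{u}) :
    X ≅ (clopenFunctor.{u}.rightOp ⋙ ultraFunctor.{u}).obj X :=
  haveI : TotallyDisconnectedSpace X.obj.carrier := X.property
  isStoneFrame.isoMk <| KHFrame.isoOfBijective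
    (Y := ((clopenFunctor.{u}.rightOp ⋙ ultraFunctor.{u}).obj X).obj)
    ⟨clopenPoint, continuous_clopenPoint⟩ ⟨clopenPoint_injective, clopenPoint_surjective⟩
    (ultraRel_clopenPoint X.obj.isContRel)

/-- The composite of `(-)^*` and `(-)_*` is the identity of `DescFrame`. -/
noncomputable def clopenUltraIso :
    clopenFunctor.{u}.rightOp ⋙ ultraFunctor.{u} ≅ 𝟭 DescFrame.{u} :=
  (NatIso.ofComponents (F := 𝟭 DescFrame.{u}) clopenPointIso fun {_ _} _ => rfl).symm

/-! ### Idempotent continuous functions -/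

section IdemClopen

variable {X : Type*} [TopologicalSpace X]

theorem idem_apply (e : Idem C(X, ℝ)) (x : X) : e.1 x = 0 ∨ e.1 x = 1 :=
  IsIdempotentElem.iff_eq_zero_or_one.1 (e.2.map (ContinuousMap.evalAlgHom ℝ ℝ x))

/-- The values of `e` are `0` and `1` only, so the closed condition `e = 1` is the same as the open
condition `e ≠ 0`. -/
theorem isClopen_idem (e : Idem C(X, ℝ)) : IsClopen {x | e.1 x = 1} := by
  refine ⟨isClosed_eq e.1.continuous continuous_const, ?_⟩
  convert isOpen_ne_fun e.1.continuous (continuous_const (y := (0 : ℝ))) using 1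
  ext x
  rcases idem_apply e x with h | h <;> simp [h]

/-- The map sending an idempotent function to the clopen set where it takes the value `1`. -/
def idemClopen (X : Type*) [TopologicalSpace X] :
    BoundedLatticeHom (Idem C(X, ℝ)) (TopologicalSpace.Clopens X) where
  toFun e := ⟨{x | e.1 x = 1}, isClopen_idem e⟩
  map_sup' e f := by
    ext x
    change (e ⊔ f).1 x = 1 ↔ e.1 x = 1 ∨ f.1 x = 1
    rw [idem_sup]
    change e.1 x + f.1 x - e.1 x * f.1 x = 1 ↔ _
    rcases idem_apply e x with h | h <;> rcases idem_apply f x with h' | h' <;> simp [h, h']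
  map_inf' e f := by
    ext x
    change e.1 x * f.1 x = 1 ↔ e.1 x = 1 ∧ f.1 x = 1
    rcases idem_apply e x with h | h <;> rcases idem_apply f x with h' | h' <;> simp [h, h']
  map_top' := by ext x; exact iff_of_true rfl trivial
  map_bot' := by ext x; exact iff_of_false (zero_ne_one (α := ℝ)) id

theorem mem_idemClopen (e : Idem C(X, ℝ)) (x : X) : x ∈ idemClopen X e ↔ e.1 x = 1 := Iff.rfl

theorem idemClopen_injective : Function.Injective (idemClopen X) := fun e f h =>
  Subtype.ext <| ContinuousMap.ext fun x => by
    have h' : e.1 x = 1 ↔ f.1 x = 1 := by rw [← mem_idemClopen, ← mem_idemClopen, h]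
    rcases idem_apply e x with he | he <;> rcases idem_apply f x with hf | hf <;> simp_all

theorem idemClopen_surjective : Function.Surjective (idemClopen X) := by
  classical
  intro U
  refine ⟨⟨⟨(U : Set X).indicator fun _ => 1, U.isClopen.continuous_indicator continuous_const⟩,
    ?_⟩, ?_⟩
  · ext x
    change (U : Set X).indicator (fun _ => (1 : ℝ)) x * (U : Set X).indicator (fun _ => (1 : ℝ)) x =
      (U : Set X).indicator (fun _ => (1 : ℝ)) x
    rw [Set.indicator_apply]
    split_ifs <;> simp
  · ext x
    change (U : Set X).indicator (fun _ => (1 : ℝ)) x = 1 ↔ x ∈ (U : Set X)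
    rw [Set.indicator_apply]
    split_ifs with h <;> simp [h]

/-- Over a nonempty `R[x]` the infimum is attained, and a minimum of a `{0, 1}`-valued function is
`1` only if the function never takes the value `0`. Over an empty `R[x]` the default value `1`
matches the vacuous truth of the right side. -/
theorem boxFun_idem_eq_one_iff [CompactSpace X] {R : X → X → Prop} (hR : IsContRel R)
    (e : Idem C(X, ℝ)) (x : X) : boxFun R e.1 x = 1 ↔ ∀ y, R x y → e.1 y = 1 := by
  by_cases hx : ∃ y, R x y
  · obtain ⟨y, hy, he, hmin⟩ := exists_boxFun hR e.1.continuous hx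
    rw [he]
    refine ⟨fun h z hz => ?_, fun h => h y hy⟩
    have := hmin z hz
    rw [h] at this
    exact (idem_apply e z).resolve_left fun h0 => by rw [h0] at this; linarith
  · exact iff_of_true (boxFun_of_empty hx) fun y hy => absurd ⟨y, hy⟩ hx

theorem idemClopen_box [CompactSpace X] {R : X → X → Prop} (hR : IsContRel R)
    (e : Idem C(X, ℝ)) :
    idemClopen X ⟨boxC hR e.1, (isModalOp_boxC hR).isIdempotentElem e.2⟩ =
      clopenBox hR (idemClopen X e) :=
  SetLike.ext fun x =>
    (boxFun_idem_eq_one_iff hR e x).trans (mem_clopenBox hR (idemClopen X e) x).symm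

end IdemClopen

/-- The idempotents of the algebra of continuous functions on a descriptive frame are its clopen
sets. -/
noncomputable def idemClopenIso (X : DescFrame.{u}ᵒᵖ) :
    (contFunctor.{u} ⋙ idFunctor.{u}).obj X ≅ clopenFunctor.{u}.obj X :=
  ModalAlg.isoOfBijective (A := (contFunctor.{u} ⋙ idFunctor.{u}).obj X)
    (B := clopenFunctor.{u}.obj X)
    ⟨idemClopen X.unop.obj.carrier, idemClopen_box X.unop.obj.isContRel⟩
    ⟨idemClopen_injective, idemClopen_surjective⟩

/-- `Id` of the algebra of continuous functions is the algebra of clopen sets. -/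
noncomputable def contIdIso : contFunctor.{u} ⋙ idFunctor.{u} ≅ clopenFunctor.{u} :=
  NatIso.ofComponents idemClopenIso fun {_ _} _ => rfl

/-! ### The triangle -/

/-- The idempotents of an algebra are the clopen sets of its Yosida space. -/
noncomputable def idYosidaClopenIso :
    idFunctor.{u} ≅ yosidaFunctor.{u}.rightOp ⋙ clopenFunctor.{u} :=
  -- Replace `A` by `C(Y_A)`, whose idempotents are the clopen sets of `Y_A`.
  Functor.isoWhiskerRight yosidaContIso.{u}.symm idFunctor.{u} ≪≫
    Functor.isoWhiskerLeft yosidaFunctor.{u}.rightOp contIdIso.{u}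

/-- The ultrafilter frame of the idempotents is the Yosida frame. -/
noncomputable def idUltraIso : idFunctor.{u}.op ⋙ ultraFunctor.{u} ≅ yosidaFunctor.{u} :=
  -- Ultrafilters of idempotents become ultrafilters of clopen sets of the Yosida space, which are
  -- its points.
  Functor.isoWhiskerRight (NatIso.op idYosidaClopenIso.{u}.symm) ultraFunctor.{u} ≪≫
    Functor.isoWhiskerLeft yosidaFunctor.{u} clopenUltraIso.{u}

/-- The ultrafilter frame of the idempotents, as a covariant functor to the opposite category. -/
noncomputable def yosidaRightOpIso :
    yosidaFunctor.{u}.rightOp ≅ idFunctor.{u} ⋙ ultraFunctor.{u}.rightOp where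
  hom := NatTrans.rightOp idUltraIso.{u}.hom
  inv := NatTrans.rightOp idUltraIso.{u}.inv
  -- Passing to `rightOp` reverses composition, so each inverse law comes from the opposite one for
  -- `idUltraIso`.
  hom_inv_id := by
    rw [← NatTrans.rightOp_id, ← idUltraIso.{u}.inv_hom_id, NatTrans.rightOp_comp]
  inv_hom_id := by
    refine (NatTrans.rightOp_comp _ _).symm.trans ?_
    rw [idUltraIso.{u}.hom_inv_id]
    exact NatTrans.rightOp_id

/-- The functor `Id` as an equivalence, with inverse `A ↦ C(A_*)`. -/
noncomputable def idEquivalence : MCubal.{u} ≌ ModalAlg.{u} :=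
  -- The unit is `1 ≅ C ∘ Y ≅ C ∘ Ult ∘ Id` and the counit is `Id ∘ C ∘ Ult ≅ Clop ∘ Ult ≅ 1`. The
  -- constructor adjusts the unit, so no triangle identity has to be verified.
  CategoryTheory.Equivalence.mk idFunctor.{u} (ultraFunctor.{u}.rightOp ⋙ contFunctor.{u})
    (yosidaContIso.{u}.symm ≪≫
      Functor.isoWhiskerRight yosidaRightOpIso.{u} contFunctor.{u})
    (Functor.isoWhiskerLeft ultraFunctor.{u}.rightOp contIdIso.{u} ≪≫ ultraClopenIso.{u})

end ModalDuality

open ModalDuality CategoryTheory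
theorem mainTheorem6 :
    idFunctor.{u}.IsEquivalence ∧
    -- the triangle commutes up to natural isomorphism
    Nonempty (idFunctor.{u}.op ⋙ ultraFunctor.{u} ≅ yosidaFunctor.{u}) ∧
    Nonempty (contFunctor.{u} ⋙ idFunctor.{u} ≅ clopenFunctor.{u}) ∧
    -- the two pairs of contravariant functors are mutually quasi-inverse
    Nonempty (yosidaFunctor.{u}.rightOp ⋙ contFunctor.{u} ≅ 𝟭 MCubal.{u}) ∧
    Nonempty (contFunctor.{u}.rightOp ⋙ yosidaFunctor.{u} ≅ 𝟭 DescFrame.{u}) ∧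
    Nonempty (ultraFunctor.{u}.rightOp ⋙ clopenFunctor.{u} ≅ 𝟭 ModalAlg.{u}) ∧
    Nonempty (clopenFunctor.{u}.rightOp ⋙ ultraFunctor.{u} ≅ 𝟭 DescFrame.{u}) :=
  ⟨idEquivalence.{u}.isEquivalence_functor, ⟨idUltraIso⟩, ⟨contIdIso⟩, ⟨yosidaContIso⟩,
    ⟨contYosidaIso⟩, ⟨ultraClopenIso⟩, ⟨clopenUltraIso⟩⟩
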